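/- Let $(p_k)_{k\in\mathbb N}$ be numbers in $(0,1)$, $q_k=1-p_k$, and let $X=(X_k)_{k\in\mathbb N}$ be independent random variables on a probability space $(\Omega,\mathcal A,\mathbb P)$ with $\mathbb P(X_k=1)=p_k$ and $\mathbb P(X_k=-1)=q_k$. Put $Y_k=(X_k-p_k+q_k)/(2\sqrt{p_kq_k})$. For $F=\mathfrak f(X_1,X_2,\dots)$ with $\mathfrak f$ measurable let $$D_kF=\sqrt{p_kq_k}\,\big(\mathfrak f(X_1,\dots,X_{k-1},+1,X_{k+1},\dots)-\mathfrak f(X_1,\dots,X_{k-1},-1,X_{k+1},\dots)\big),\qquad DF=(D_kF)_{k\in\mathbb N},$$ and let $\mathbb D^{1,2}$ be the set of $F\in L^2(\Omega,\sigma\{X\},\mathbb P)$ with $\mathbb E\big[\sum_k(D_kF)^2\big]<\infty$. Let $\mathbb C_n$ be the $n$-th Rademacher chaos, that is, the closed linear span in $L^2(\mathbb P)$ of the products $Y_{i_1}\cdots Y_{i_n}$ with pairwise distinct $i_1,\dots,i_n$, and for $F\in L^2(\Omega,\sigma\{X\},\mathbb P)$ let $L^{-1}F=-\sum_{n\ge1}\frac1n\,\mathrm{proj}_{\mathbb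 C_n}F$ (orthogonal projections; convergence in $L^2(\mathbb P)$). Let $\mathrm{Dom}(\delta)$ be the set of $u=(u_k)_{k\in\mathbb N}$, with $u_k$ measurable with respect to $\sigma\{X\}$ and $\mathbb E\big[\sum_ku_k^2\big]<\infty$, for which there is a constant $C_u>0$ such that $\big|\mathbb E\big[\sum_k(D_kG)u_k\big]\big|\le C_u\sqrt{\mathbb E[G^2]}$ for all $G\in\mathbb D^{1,2}$. Let $\Phi$ be the distribution function of $N\sim\mathcal N(0,1)$, let $f_z(x)=e^{x^2/2}\int_{-\infty}^x(\mathbf 1_{\{t\le z\}}-\Phi(z))e^{-t^2/2}\,dt$ be the bounded solution of Stein's equation $f'(x)-xf(x)=\mathbf 1_{\{x\le z\}}-\Phi(z)$, and let $d_K(F,N)=\sup_{z\in\mathbb R}|\mathbb P(F\le z)-\Phi(z)|$. Let $F\in\mathbb D^{1,2}$ have mean zero and variance one, and define, as elements of $[0,\infty]$ (with $0\cdot\infty=0$), $$B_1=\sum_{j,k,\ell\in\mathbb N}\sqrt{\mathbb E[(D_jF)^2(D_kF)^2]}\sqrt{\mathbb E[(D_\ell D_jF)^2(D_\ell D_kF)^2]},\qquad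 B_2=\sum_{j,k,\ell\in\mathbb N}\frac1{p_\ell q_\ell}\mathbb E[(D_\ell D_jF)^2(D_\ell D_kF)^2],$$ $$B_3=\sum_{k\in\mathbb N}\frac1{p_kq_k}\mathbb E[(D_kF)^4],\qquad B_4=\sum_{k,\ell\in\mathbb N}\frac1{p_kq_k}\sqrt{\mathbb E[(D_kF)^4]}\sqrt{\mathbb E[(D_\ell D_kF)^4]},\qquad B_5=\sum_{k,\ell\in\mathbb N}\frac1{p_kq_kp_\ell q_\ell}\mathbb E[(D_\ell D_kF)^4].$$ Then the following hold. (1) If $Ff_z(F)+\mathbf 1_{\{F>z\}}\in\mathbb D^{1,2}$ for all $z\in\mathbb R$, and the sequence $\big((p_kq_k)^{-1/2}\,D_kF\,|D_kL^{-1}F|\big)_{k\in\mathbb N}$ belongs to $\mathrm{Dom}(\delta)$, then $$d_K(F,N)\le\frac{\sqrt{15}}2\sqrt{B_1}+\frac{\sqrt3}2\sqrt{B_2}+2\sqrt{B_3}+2\sqrt6\sqrt{B_4}+2\sqrt3\sqrt{B_5}.$$ (2) If $D_kF\in L^4(\Omega)$ for every $k\in\mathbb N$, and if either (a) $\sum_{k\in\mathbb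 N}p_kq_k<\infty$ or (b) $F$ depends only on the first $m$ variables $X_1,\dots,X_m$ for some $m\in\mathbb N$, then $$d_K(F,N)\le\frac{\sqrt{15}}2\sqrt{B_1}+\frac{\sqrt3}2\sqrt{B_2}+4\sqrt\kappa\,\sqrt{B_3},$$ where $\kappa=\sum_{k\in\mathbb N}p_kq_k$ in case (a) and $\kappa=\sum_{k=1}^mp_kq_k$ in case (b). -/

import Mathlib

open MeasureTheory ProbabilityTheory
open scoped ENNReal

namespace Rademacher

noncomputable section

/-- `X` is a sequence of independent Rademacher random variables on `(Ω, P)` with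
`P(X_k = 1) = p_k ∈ (0,1)` and `P(X_k = -1) = 1 - p_k`. The index set is `{0, 1, 2, …}`. -/
structure IsRademacherSequence {Ω : Type*} [MeasurableSpace Ω] (p : ℕ → ℝ) (X : ℕ → Ω → ℝ)
    (P : Measure Ω) : Prop where
  pos : ∀ k, 0 < p k
  lt_one : ∀ k, p k < 1
  measurable : ∀ k, Measurable (X k)
  indep : iIndepFun X P
  prob_one : ∀ k, P {ω | X k ω = 1} = ENNReal.ofReal (p k)
  prob_neg_one : ∀ k, P {ω | X k ω = -1} = ENNReal.ofReal (1 - p k)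

/-- The law of the whole sequence `X` on `ℝ^ℕ`. The space `L²(Ω, σ{X}, P)` is identified with
`L²` of this law through `𝔣 ↦ 𝔣(X)`; all operators below act on functionals `𝔣 : ℝ^ℕ → ℝ`. -/
def seqLaw {Ω : Type*} [MeasurableSpace Ω] (X : ℕ → Ω → ℝ) (P : Measure Ω) : Measure (ℕ → ℝ) :=
  P.map (fun ω k => X k ω)

/-- The discrete gradient
`D_k F = √(p_k q_k) (𝔣(…, x_{k-1}, +1, x_{k+1}, …) - 𝔣(…, x_{k-1}, -1, x_{k+1}, …))`. -/
def grad (p : ℕ → ℝ) (k : ℕ) (f : (ℕ → ℝ) → ℝ) : (ℕ → ℝ) → ℝ := fun x =>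
  √(p k * (1 - p k)) * (f (Function.update x k 1) - f (Function.update x k (-1)))

/-- The normalized variable `Y_k = (X_k - p_k + q_k) / (2 √(p_k q_k))`. -/
def normalized (p : ℕ → ℝ) (k : ℕ) : (ℕ → ℝ) → ℝ := fun x =>
  (x k - p k + (1 - p k)) / (2 * √(p k * (1 - p k)))

/-- The product `∏_{k ∈ A} Y_k`. -/
def walsh (p : ℕ → ℝ) (A : Finset ℕ) : (ℕ → ℝ) → ℝ := fun x => ∏ k ∈ A, normalized p k x

/-- The `n`-th Rademacher chaos: the closed linear span in `L²` of the products
`Y_{i_1} ⋯ Y_{i_n}` with pairwise distinct indices. -/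
abbrev chaos (p : ℕ → ℝ) (μ : Measure (ℕ → ℝ)) (n : ℕ) : Submodule ℝ (Lp ℝ 2 μ) :=
  (Submodule.span ℝ
    {G : Lp ℝ 2 μ | ∃ A : Finset ℕ, A.card = n ∧ G =ᵐ[μ] walsh p A}).topologicalClosure

/-- The pseudo-inverse `L⁻¹F = ∑_{n ≥ 1} -(1/n) J_n(f_n)` of the Ornstein-Uhlenbeck operator, where
`J_n(f_n)`, the `n`-th term of the chaos expansion of `F`, is the orthogonal projection of `F`
onto the `n`-th chaos; the series converges in `L²`. The result is a representative, as a
functional on `ℝ^ℕ`, of the element `L⁻¹F` of `L²`. -/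
def pseudoInverse (p : ℕ → ℝ) (μ : Measure (ℕ → ℝ)) (f : (ℕ → ℝ) → ℝ) (hf : MemLp f 2 μ) :
    (ℕ → ℝ) → ℝ :=
  ⇑(∑' n : ℕ, (-(1 / ((n : ℝ) + 1))) • (chaos p μ (n + 1)).starProjection (hf.toLp f))

/-- The space `𝔻^{1,2}`: square-integrable functionals with `E[∑_k (D_k F)²] < ∞`. -/
structure MemD12 (p : ℕ → ℝ) (μ : Measure (ℕ → ℝ)) (f : (ℕ → ℝ) → ℝ) : Prop where
  memLp : MemLp f 2 μ
  grad_lt_top : ∫⁻ x, ∑' k, ‖grad p k f x‖ₑ ^ 2 ∂μ < ∞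

/-- The domain of the divergence `δ`: square-integrable `ℓ²`-valued `u` such that
`|E⟨DG, u⟩| ≤ C √(E[G²])` for all `G ∈ 𝔻^{1,2}`, with a constant `C` that depends on `u` only. -/
structure MemDomDelta (p : ℕ → ℝ) (μ : Measure (ℕ → ℝ)) (u : ℕ → (ℕ → ℝ) → ℝ) : Prop where
  aestronglyMeasurable : ∀ k, AEStronglyMeasurable (u k) μ
  sq_lt_top : ∫⁻ x, ∑' k, ‖u k x‖ₑ ^ 2 ∂μ < ∞
  bound : ∃ C : ℝ, 0 < C ∧ ∀ g : (ℕ → ℝ) → ℝ, MemD12 p μ g →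
    |∫ x, ∑' k, grad p k g x * u k x ∂μ| ≤ C * √(∫ x, g x ^ 2 ∂μ)

/-- The sequence `(p_k q_k)^{-1/2} D_kF |D_k L⁻¹F|`. -/
def uSeq (p : ℕ → ℝ) (μ : Measure (ℕ → ℝ)) (f : (ℕ → ℝ) → ℝ) (hf : MemLp f 2 μ) (k : ℕ) :
    (ℕ → ℝ) → ℝ := fun x =>
  (√(p k * (1 - p k)))⁻¹ * grad p k f x * |grad p k (pseudoInverse p μ f hf) x|

/-- The standard normal distribution function `Φ`. -/
def Phi (z : ℝ) : ℝ := (gaussianReal 0 1).real (Set.Iic z)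

/-- The (bounded) solution `f_z(w) = e^{w²/2} ∫_{-∞}^w (1_{t ≤ z} - Φ(z)) e^{-t²/2} dt` of Stein's
equation `f'(w) - w f(w) = 1_{w ≤ z} - Φ(z)`, with the integral evaluated. -/
def steinSol (z w : ℝ) : ℝ :=
  if w ≤ z then √(2 * Real.pi) * Real.exp (w ^ 2 / 2) * Phi w * (1 - Phi z)
  else √(2 * Real.pi) * Real.exp (w ^ 2 / 2) * Phi z * (1 - Phi w)

/-- The functional `F f_z(F) + 1_{F > z}`. -/
def steinFunctional (z : ℝ) (f : (ℕ → ℝ) → ℝ) : (ℕ → ℝ) → ℝ := fun x =>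
  f x * steinSol z (f x) + Set.indicator (Set.Ioi z) (fun _ => (1 : ℝ)) (f x)

/-- The Kolmogorov distance of two laws on the real line (a number in `[0, 1]`). -/
def kolmogorovDist (ν₁ ν₂ : Measure ℝ) : ℝ≥0∞ :=
  ⨆ z : ℝ, ENNReal.ofReal |ν₁.real (Set.Iic z) - ν₂.real (Set.Iic z)|

/-- The square root on `[0, ∞]`. -/
def esqrt (a : ℝ≥0∞) : ℝ≥0∞ := a ^ (1 / 2 : ℝ)

/-- The weight `1 / (p_k q_k)`. -/
def weight (p : ℕ → ℝ) (k : ℕ) : ℝ≥0∞ := ENNReal.ofReal (1 / (p k * (1 - p k)))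

/-- `B₁`, a number in `[0, ∞]`, as are all the following ones. -/
def B1 (p : ℕ → ℝ) (μ : Measure (ℕ → ℝ)) (f : (ℕ → ℝ) → ℝ) : ℝ≥0∞ :=
  ∑' (j : ℕ) (k : ℕ) (l : ℕ),
    esqrt (∫⁻ x, ‖grad p j f x‖ₑ ^ 2 * ‖grad p k f x‖ₑ ^ 2 ∂μ) *
    esqrt (∫⁻ x, ‖grad p l (grad p j f) x‖ₑ ^ 2 * ‖grad p l (grad p k f) x‖ₑ ^ 2 ∂μ)

/-- `B₂`. -/
def B2 (p : ℕ → ℝ) (μ : Measure (ℕ → ℝ)) (f : (ℕ → ℝ) → ℝ) : ℝ≥0∞ :=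
  ∑' (j : ℕ) (k : ℕ) (l : ℕ), weight p l *
    ∫⁻ x, ‖grad p l (grad p j f) x‖ₑ ^ 2 * ‖grad p l (grad p k f) x‖ₑ ^ 2 ∂μ

/-- `B₃`. -/
def B3 (p : ℕ → ℝ) (μ : Measure (ℕ → ℝ)) (f : (ℕ → ℝ) → ℝ) : ℝ≥0∞ :=
  ∑' k : ℕ, weight p k * ∫⁻ x, ‖grad p k f x‖ₑ ^ 4 ∂μ

/-- `B₄`. -/
def B4 (p : ℕ → ℝ) (μ : Measure (ℕ → ℝ)) (f : (ℕ → ℝ) → ℝ) : ℝ≥0∞ :=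
  ∑' (k : ℕ) (l : ℕ), weight p k * esqrt (∫⁻ x, ‖grad p k f x‖ₑ ^ 4 ∂μ) *
    esqrt (∫⁻ x, ‖grad p l (grad p k f) x‖ₑ ^ 4 ∂μ)

/-- `B₅`. -/
def B5 (p : ℕ → ℝ) (μ : Measure (ℕ → ℝ)) (f : (ℕ → ℝ) → ℝ) : ℝ≥0∞ :=
  ∑' (k : ℕ) (l : ℕ), weight p k * weight p l *
    ∫⁻ x, ‖grad p l (grad p k f) x‖ₑ ^ 4 ∂μ

end

end Rademacher

/-! The proof is Stein's method combined with a covariance formula over finitely many coordinates.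

Covariance. For `A ⊆ {0, …, n-1}` let `E[f | A]` be the mean of `f` with all coordinates outside `A`
resampled. One coordinate contributes `Y_k E[D_k f | A] = E[f | A ∪ {k}] - E[f | A \ {k}]`. Average
this over a random `A` with weight `|A|! (n-|A|)! / (n+1)! = ∫₀¹ t^|A| (1-t)^(n-|A|) dt` and sum
over `k < n`: the right side telescopes to `E[f | {0, …, n-1}] - E[f]`. Testing against `g` and
integrating by parts gives `covariance_formula`, in which `G_k`, the average of `E[D_k f | A]`
(`mixMean`), plays the role of `-D_k L⁻¹` applied to the truncation of `f` to `n` coordinates. Only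
finite sums occur; `n → ∞` is taken at the end by martingale convergence.

Stein's equation. `P(F ≤ z) - Φ(z) = E[f_z'(F)] - E[F f_z(F)]`. The covariance formula turns the
truncated form of the last expectation into `∑ E[D_k f_z(F) G_k]`, and `D_k f_z(F) = f_z'(F) D_k F +
R_k`. Hence, with the kernel `T = ∑ D_k F G_k`, the error is `E[f_z'(F)(1 - T)] - ∑ E[R_k G_k]`.

Main term. Since `|f_z'| ≤ 1` and `E[T] → Var F = 1`, it remains to bound `E|T - E[T]|`. The
Poincaré inequality reduces this to `∑ E[(D_l T)²]`, and the product rule with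
`lintegral_sum_mul_mix_sq_le` gives `(15/4) B₁ + (3/4) B₂`.

Remainder. The function `h(w) = w f_z(w) + 1_{w > z}` is increasing with `|h| ≤ 2`, and it controls
the oscillation of `f_z'`; so `|R_k G_k| ≤ D_k h(F) u_k` with `u_k = (p_k q_k)^{-1/2} D_k F |G_k|`.
For (2), `|D_k h(F)| ≤ 4 √(p_k q_k)` and Cauchy–Schwarz suffice. For (1), integration by parts
yields `E[h(F) ∑ Y_k u_k]`, and the second moment of `∑ Y_k u_k` is bounded by a Skorohod-type
isometry, giving `B₃ + 6 B₄ + 3 B₅`. -/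

namespace Rademacher

noncomputable section

/-! ### The law of the sign sequence: resampling and splitting. -/

/-- The properties of the law of a sequence of independent Rademacher variables that are used
below: resampling the coordinates outside a finite set, and splitting along one coordinate. -/
structure IsRademacherLaw (p : ℕ → ℝ) (μ : Measure (ℕ → ℝ)) : Prop where
  pos : ∀ k, 0 < p k
  lt_one : ∀ k, p k < 1
  resample : ∀ A : Finset ℕ, MeasurePreserving
    (fun z : (ℕ → ℝ) × (ℕ → ℝ) => A.piecewise z.1 z.2) (μ.prod μ) μ
  split : ∀ k, μ = ENNReal.ofReal (p k) • μ.map (fun x => Function.update x k 1) +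
    ENNReal.ofReal (1 - p k) • μ.map (fun x => Function.update x k (-1))

lemma measurable_piecewise_prod (A : Finset ℕ) :
    Measurable (fun z : (ℕ → ℝ) × (ℕ → ℝ) => A.piecewise z.1 z.2) := by
  refine measurable_pi_lambda _ fun i => ?_
  by_cases h : i ∈ A
  · simp only [Finset.piecewise, h, if_true]; fun_prop
  · simp only [Finset.piecewise, h, if_false]; fun_prop

lemma measurable_update_const (k : ℕ) (c : ℝ) :
    Measurable (fun x : ℕ → ℝ => Function.update x k c) :=
  measurable_pi_lambda _ fun i => by
    by_cases h : i = k
    · subst h; simp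
    · simp only [Function.update_of_ne h]; fun_prop

/-- A product measure is determined by finite boxes, and the preimage of a box over `s` is the
product of its parts over `s ∩ A` and `s \ A`. This is what allows conditional expectations to be
written as integrals over an independent copy. -/
lemma measurePreserving_piecewise (ν : ℕ → Measure ℝ) [∀ k, IsProbabilityMeasure (ν k)]
    (A : Finset ℕ) : MeasurePreserving (fun z : (ℕ → ℝ) × (ℕ → ℝ) => A.piecewise z.1 z.2)
      ((Measure.infinitePi ν).prod (Measure.infinitePi ν)) (Measure.infinitePi ν) := by
  refine ⟨measurable_piecewise_prod A, Measure.eq_infinitePi _ fun s t ht => ?_⟩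
  rw [Measure.map_apply (measurable_piecewise_prod A)
    (MeasurableSet.pi s.countable_toSet fun i _ => ht i)]
  have : (fun z : (ℕ → ℝ) × (ℕ → ℝ) => A.piecewise z.1 z.2) ⁻¹' (s : Set ℕ).pi t =
      (((s ∩ A : Finset ℕ) : Set ℕ).pi t) ×ˢ (((s \ A : Finset ℕ) : Set ℕ).pi t) := by
    ext z
    simp only [Set.mem_preimage, Set.mem_pi, Set.mem_prod, Finset.coe_inter, Finset.coe_sdiff,
      Set.mem_inter_iff, Set.mem_sdiff, Finset.mem_coe, Finset.piecewise]
    constructor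
    · intro h
      refine ⟨fun i hi => ?_, fun i hi => ?_⟩
      · simpa [hi.2] using h i hi.1
      · simpa [hi.2] using h i hi.1
    · rintro ⟨h1, h2⟩ i hi
      by_cases hA : i ∈ A
      · simpa [hA] using h1 i ⟨hi, hA⟩
      · simpa [hA] using h2 i ⟨hi, hA⟩
  rw [this, Measure.prod_prod, Measure.infinitePi_pi _ fun i _ => ht i,
    Measure.infinitePi_pi _ fun i _ => ht i, ← Finset.prod_inter_mul_prod_sdiff s A]

lemma map_eq_of_isRademacherSequence {Ω : Type*} [MeasurableSpace Ω] {P : Measure Ω}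
    [IsProbabilityMeasure P] {p : ℕ → ℝ} {X : ℕ → Ω → ℝ} (hX : IsRademacherSequence p X P)
    (k : ℕ) : P.map (X k) = ENNReal.ofReal (p k) • Measure.dirac (1 : ℝ) +
      ENNReal.ofReal (1 - p k) • Measure.dirac (-1) := by
  have hm := hX.measurable k
  set ρ := P.map (X k)
  have : IsProbabilityMeasure ρ := Measure.isProbabilityMeasure_map hm.aemeasurable
  have h1 : ρ {1} = ENNReal.ofReal (p k) := by
    rw [← hX.prob_one k, Measure.map_apply hm (measurableSet_singleton _)]; rfl
  have h2 : ρ {-1} = ENNReal.ofReal (1 - p k) := by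
    rw [← hX.prob_neg_one k, Measure.map_apply hm (measurableSet_singleton _)]; rfl
  have h3 : ρ ({1, -1} : Set ℝ)ᶜ = 0 := by
    rw [prob_compl_eq_zero_iff ((Set.finite_singleton _).insert _).measurableSet,
      Set.insert_eq, measure_union (by norm_num) (measurableSet_singleton _), h1, h2,
      ← ENNReal.ofReal_add (hX.pos k).le (by linarith [hX.lt_one k])]
    simp
  have h4 : ρ.restrict {1, -1} = ρ :=
    Measure.restrict_eq_self_of_ae_mem (by rw [ae_iff]; exact h3)
  rw [← h4, Set.insert_eq, Measure.restrict_union (by norm_num) (measurableSet_singleton _),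
    Measure.restrict_singleton, Measure.restrict_singleton, h1, h2]

/-- The only place where independence enters: it makes the law an infinite product, and both
structural properties are then checked on boxes. -/
lemma isRademacherLaw_seqLaw {Ω : Type*} [MeasurableSpace Ω] {P : Measure Ω}
    [IsProbabilityMeasure P] {p : ℕ → ℝ} {X : ℕ → Ω → ℝ} (hX : IsRademacherSequence p X P) :
    IsRademacherLaw p (seqLaw X P) := by
  have (k : ℕ) : IsProbabilityMeasure (P.map (X k)) :=
    Measure.isProbabilityMeasure_map (hX.measurable k).aemeasurable
  have hμ : seqLaw X P = Measure.infinitePi fun k => P.map (X k) :=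
    (iIndepFun_iff_map_fun_eq_infinitePi_map hX.measurable).1 hX.indep
  rw [hμ]
  refine ⟨hX.pos, hX.lt_one, measurePreserving_piecewise _, fun k => ?_⟩
  symm
  refine Measure.eq_infinitePi _ fun s t ht => ?_
  have hpi : MeasurableSet ((s : Set ℕ).pi t) := MeasurableSet.pi s.countable_toSet fun i _ => ht i
  have key (c : ℝ) : (Measure.infinitePi fun k => P.map (X k)).map
      (fun x => Function.update x k c) ((s : Set ℕ).pi t) =
        (∏ i ∈ s.erase k, P.map (X i) (t i)) * (if k ∈ s then Measure.dirac c (t k) else 1) := by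
    rw [Measure.map_apply (measurable_update_const k c) hpi]
    by_cases hk : k ∈ s
    · by_cases hc : c ∈ t k
      · have : (fun x : ℕ → ℝ => Function.update x k c) ⁻¹' (s : Set ℕ).pi t =
            ((s.erase k : Finset ℕ) : Set ℕ).pi t := by
          ext x
          simp only [Set.mem_preimage, Set.mem_pi, Finset.mem_coe, Finset.mem_erase]
          constructor
          · rintro h i ⟨hi, his⟩
            simpa [hi] using h i his
          · intro h i hi
            by_cases hik : i = k
            · subst hik; simpa using hc
            · simpa [hik] using h i ⟨hik, hi⟩
        rw [this, Measure.infinitePi_pi _ fun i _ => ht i]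
        simp [hk, Measure.dirac_apply' _ (ht k), hc]
      · have : (fun x : ℕ → ℝ => Function.update x k c) ⁻¹' (s : Set ℕ).pi t = ∅ := by
          ext x
          simp only [Set.mem_preimage, Set.mem_pi, Set.mem_empty_iff_false, iff_false]
          intro h
          exact hc (by simpa using h k hk)
        rw [this]
        simp [hk, Measure.dirac_apply' _ (ht k), hc]
    · have : (fun x : ℕ → ℝ => Function.update x k c) ⁻¹' (s : Set ℕ).pi t = (s : Set ℕ).pi t := by
        ext x
        simp only [Set.mem_preimage, Set.mem_pi]
        refine forall₂_congr fun i hi => ?_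
        rw [Function.update_of_ne (by rintro rfl; exact hk hi)]
      rw [this, Measure.infinitePi_pi _ fun i _ => ht i]
      simp [hk]
  rw [Measure.add_apply, Measure.smul_apply, Measure.smul_apply, key, key]
  by_cases hk : k ∈ s
  · rw [← Finset.prod_erase_mul _ _ hk]
    simp only [hk, if_true, smul_eq_mul]
    rw [map_eq_of_isRademacherSequence hX k]
    rw [Measure.add_apply, Measure.smul_apply, Measure.smul_apply, smul_eq_mul, smul_eq_mul]
    ring
  · simp only [hk, if_false, smul_eq_mul, mul_one]
    rw [← add_mul, ← ENNReal.ofReal_add (hX.pos k).le (by linarith [hX.lt_one k])]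
    simp [Finset.erase_eq_of_notMem hk]

/-! ### Calculus of the discrete gradient along one coordinate. -/

/-- A functional does not depend on the coordinate `k`. -/
def Free (k : ℕ) (f : (ℕ → ℝ) → ℝ) : Prop := ∀ x c, f (Function.update x k c) = f x

lemma free_grad (p : ℕ → ℝ) (k : ℕ) (f : (ℕ → ℝ) → ℝ) : Free k (grad p k f) := fun x c => by
  simp [grad]

lemma Free.grad_eq_zero {p : ℕ → ℝ} {k : ℕ} {f : (ℕ → ℝ) → ℝ} (h : Free k f) :
    grad p k f = 0 := by
  funext x; simp [grad, h x]

lemma Free.grad {p : ℕ → ℝ} {k l : ℕ} {f : (ℕ → ℝ) → ℝ} (h : Free k f) :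
    Free k (grad p l f) := fun x c => by
  by_cases hkl : k = l
  · subst hkl; exact free_grad _ _ _ _ _
  · simp only [Rademacher.grad, Function.update_comm hkl, h _ c]

lemma Free.mul {k : ℕ} {f g : (ℕ → ℝ) → ℝ} (hf : Free k f) (hg : Free k g) :
    Free k (fun x => f x * g x) := fun x c => by simp [hf x c, hg x c]

lemma grad_mul_of_free {p : ℕ → ℝ} {k : ℕ} {f g : (ℕ → ℝ) → ℝ} (hg : Free k g) (x : ℕ → ℝ) :
    grad p k (fun x => f x * g x) x = grad p k f x * g x := by
  simp only [grad, hg x]; ring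

lemma measurable_grad {p : ℕ → ℝ} {k : ℕ} {f : (ℕ → ℝ) → ℝ} (hf : Measurable f) :
    Measurable (grad p k f) :=
  ((hf.comp (measurable_update_const k 1)).sub
    (hf.comp (measurable_update_const k (-1)))).const_mul _

lemma measurable_normalized (p : ℕ → ℝ) (k : ℕ) : Measurable (normalized p k) := by
  unfold normalized; fun_prop

lemma free_normalized (p : ℕ → ℝ) {k l : ℕ} (h : k ≠ l) : Free k (normalized p l) := fun x c => by
  simp [normalized, Function.update_of_ne h.symm]

namespace IsRademacherLaw

variable {p : ℕ → ℝ} {μ : Measure (ℕ → ℝ)} (hμ : IsRademacherLaw p μ)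

include hμ

lemma mul_pos (k : ℕ) : 0 < p k * (1 - p k) :=
  _root_.mul_pos (hμ.pos k) (by linarith [hμ.lt_one k])

lemma sqrt_pos (k : ℕ) : 0 < √(p k * (1 - p k)) := Real.sqrt_pos.2 (hμ.mul_pos k)

/-- By `split`, the law with coordinate `k` frozen, times `p k` or `1 - p k`, is dominated by `μ`.
Integrability and almost sure statements therefore survive freezing a coordinate. -/
lemma exists_map_update_le (k : ℕ) {c : ℝ} (hc : c = 1 ∨ c = -1) :
    ∃ C : ℝ≥0∞, C ≠ ∞ ∧ μ.map (fun x => Function.update x k c) ≤ C • μ := by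
  have aux (a : ℝ) (ha : 0 < a) (ν : Measure (ℕ → ℝ)) (h : ENNReal.ofReal a • ν ≤ μ) :
      ν ≤ (ENNReal.ofReal a)⁻¹ • μ := by
    intro s
    have := h s
    rw [Measure.smul_apply, smul_eq_mul] at this ⊢
    rw [← ENNReal.mul_le_iff_le_inv (by simpa using ha) ENNReal.ofReal_ne_top]
    exact this
  rcases hc with rfl | rfl
  · refine ⟨_, ?_, aux (p k) (hμ.pos k) _ ?_⟩
    · simpa using hμ.pos k
    · nth_rw 2 [hμ.split k]; exact Measure.le_add_right le_rfl
  · refine ⟨_, ?_, aux (1 - p k) (by linarith [hμ.lt_one k]) _ ?_⟩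
    · simpa using hμ.lt_one k
    · nth_rw 2 [hμ.split k]; exact Measure.le_add_left le_rfl

lemma memLp_update {r : ℝ≥0∞} {f : (ℕ → ℝ) → ℝ} (hf : MemLp f r μ) (k : ℕ) {c : ℝ}
    (hc : c = 1 ∨ c = -1) : MemLp (fun x => f (Function.update x k c)) r μ := by
  obtain ⟨C, hC, hle⟩ := hμ.exists_map_update_le k hc
  exact (hf.of_measure_le_smul hC hle).comp_of_map (measurable_update_const k c).aemeasurable

lemma integrable_update {f : (ℕ → ℝ) → ℝ} (hf : Integrable f μ) (k : ℕ) {c : ℝ}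
    (hc : c = 1 ∨ c = -1) : Integrable (fun x => f (Function.update x k c)) μ := by
  rw [← memLp_one_iff_integrable] at hf ⊢
  exact hμ.memLp_update hf k hc

lemma memLp_grad {r : ℝ≥0∞} {f : (ℕ → ℝ) → ℝ} (hf : MemLp f r μ) (k : ℕ) :
    MemLp (grad p k f) r μ :=
  ((hμ.memLp_update hf k (.inl rfl)).sub (hμ.memLp_update hf k (.inr rfl))).const_mul _

lemma integrable_grad {f : (ℕ → ℝ) → ℝ} (hf : Integrable f μ) (k : ℕ) :
    Integrable (grad p k f) μ := by
  rw [← memLp_one_iff_integrable] at hf ⊢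
  exact hμ.memLp_grad hf k

lemma ae_update {P : (ℕ → ℝ) → Prop} (h : ∀ᵐ x ∂μ, P x) (k : ℕ) {c : ℝ}
    (hc : c = 1 ∨ c = -1) : ∀ᵐ x ∂μ, P (Function.update x k c) := by
  obtain ⟨C, -, hle⟩ := hμ.exists_map_update_le k hc
  have hac : μ.map (fun x => Function.update x k c) ≪ μ :=
    (Measure.absolutelyContinuous_of_le hle).trans Measure.smul_absolutelyContinuous
  exact ae_of_ae_map (measurable_update_const k c).aemeasurable (hac.ae_le h)

lemma integral_split {f : (ℕ → ℝ) → ℝ} (hf : Integrable f μ) (k : ℕ) :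
    ∫ x, f x ∂μ = ∫ x, (p k * f (Function.update x k 1) +
      (1 - p k) * f (Function.update x k (-1))) ∂μ := by
  obtain ⟨C, hC, hle⟩ := hμ.exists_map_update_le k (.inl rfl)
  obtain ⟨C', hC', hle'⟩ := hμ.exists_map_update_le k (.inr rfl)
  have h1 := hf.of_measure_le_smul hC hle
  have h2 := hf.of_measure_le_smul hC' hle'
  conv_lhs => rw [hμ.split k]
  rw [integral_add_measure (h1.smul_measure ENNReal.ofReal_ne_top)
    (h2.smul_measure ENNReal.ofReal_ne_top), integral_smul_measure, integral_smul_measure,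
    integral_map (measurable_update_const k _).aemeasurable h1.1,
    integral_map (measurable_update_const k _).aemeasurable h2.1,
    ENNReal.toReal_ofReal (hμ.pos k).le, ENNReal.toReal_ofReal (by linarith [hμ.lt_one k]),
    smul_eq_mul, smul_eq_mul, ← integral_const_mul, ← integral_const_mul, integral_add]
  · exact (hμ.integrable_update hf k (.inl rfl)).const_mul _
  · exact (hμ.integrable_update hf k (.inr rfl)).const_mul _

lemma ae_sign (k : ℕ) : ∀ᵐ x ∂μ, x k = 1 ∨ x k = -1 := by
  have hs : MeasurableSet {x : ℕ → ℝ | ¬ (x k = 1 ∨ x k = -1)} :=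
    ((measurableSet_eq_fun (measurable_pi_apply k) measurable_const).union
      (measurableSet_eq_fun (measurable_pi_apply k) measurable_const)).compl
  rw [ae_iff, hμ.split k, Measure.add_apply, Measure.smul_apply, Measure.smul_apply,
    Measure.map_apply (measurable_update_const k _) hs,
    Measure.map_apply (measurable_update_const k _) hs]
  simp

lemma normalized_update_one (x : ℕ → ℝ) (k : ℕ) :
    p k * normalized p k (Function.update x k 1) = √(p k * (1 - p k)) := by
  have h := hμ.sqrt_pos k
  have h2 := Real.mul_self_sqrt (hμ.mul_pos k).le
  simp only [normalized, Function.update_self]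
  field_simp
  linear_combination -2 * h2

lemma normalized_update_neg_one (x : ℕ → ℝ) (k : ℕ) :
    (1 - p k) * normalized p k (Function.update x k (-1)) = -√(p k * (1 - p k)) := by
  have h := hμ.sqrt_pos k
  have h2 := Real.mul_self_sqrt (hμ.mul_pos k).le
  simp only [normalized, Function.update_self]
  field_simp
  linear_combination 2 * h2

lemma exists_norm_normalized_le (k : ℕ) : ∃ C, ∀ᵐ x ∂μ, ‖normalized p k x‖ ≤ C := by
  refine ⟨2 / √(p k * (1 - p k)), ?_⟩
  filter_upwards [hμ.ae_sign k] with x hx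
  have h := hμ.sqrt_pos k
  have h0 := hμ.pos k
  have h1 := hμ.lt_one k
  rw [normalized, norm_div, Real.norm_eq_abs, Real.norm_eq_abs, abs_of_pos (by positivity : 0 <
    2 * √(p k * (1 - p k))), div_le_div_iff₀ (by positivity) h]
  have : |x k - p k + (1 - p k)| ≤ 4 := by
    rcases hx with hx | hx <;> rw [hx, abs_le] <;> constructor <;> linarith
  nlinarith

lemma memLp_normalized_mul {r : ℝ≥0∞} {f : (ℕ → ℝ) → ℝ} (hf : MemLp f r μ) (k : ℕ) :
    MemLp (fun x => normalized p k x * f x) r μ := by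
  obtain ⟨C, hC⟩ := hμ.exists_norm_normalized_le k
  refine hf.of_le_mul (c := C)
    ((measurable_normalized p k).aestronglyMeasurable.mul hf.1) ?_
  filter_upwards [hC] with x hx
  rw [norm_mul]
  gcongr

lemma integrable_normalized_mul {f : (ℕ → ℝ) → ℝ} (hf : Integrable f μ) (k : ℕ) :
    Integrable (fun x => normalized p k x * f x) μ := by
  rw [← memLp_one_iff_integrable] at hf ⊢
  exact hμ.memLp_normalized_mul hf k

/-- Integration by parts along one coordinate. -/
lemma integral_normalized_mul {f : (ℕ → ℝ) → ℝ} (hf : Integrable f μ) (k : ℕ) :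
    ∫ x, normalized p k x * f x ∂μ = ∫ x, grad p k f x ∂μ := by
  rw [hμ.integral_split (hμ.integrable_normalized_mul hf k) k]
  congr 1 with x
  rw [grad, ← mul_assoc, ← mul_assoc, hμ.normalized_update_one, hμ.normalized_update_neg_one]
  ring

lemma integral_grad_mul {f g : (ℕ → ℝ) → ℝ} {k : ℕ} (hg : Free k g)
    (hfg : Integrable (fun x => f x * g x) μ) :
    ∫ x, grad p k f x * g x ∂μ = ∫ x, f x * (normalized p k x * g x) ∂μ := by
  have := hμ.integral_normalized_mul hfg k
  simp only [grad_mul_of_free hg] at this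
  rw [← this]
  congr 1 with x
  ring

/-- The decomposition of a functional along one coordinate. -/
lemma eq_mean_add {f : (ℕ → ℝ) → ℝ} {k : ℕ} {x : ℕ → ℝ} (hx : x k = 1 ∨ x k = -1) :
    f x = (p k * f (Function.update x k 1) + (1 - p k) * f (Function.update x k (-1))) +
      normalized p k x * grad p k f x := by
  have h := hμ.sqrt_pos k
  have key : normalized p k x * √(p k * (1 - p k)) = (x k - p k + (1 - p k)) / 2 := by
    rw [normalized]; field_simp
  rw [grad, ← mul_assoc, key]
  rcases hx with hx | hx
  · rw [hx, show Function.update x k 1 = x by rw [← hx, Function.update_eq_self]]; ring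
  · rw [hx, show Function.update x k (-1) = x by rw [← hx, Function.update_eq_self]]; ring

end IsRademacherLaw

/-! ### Conditional means given finitely many coordinates. -/

/-- The conditional mean of `f` given the coordinates in `A`, under a product law. -/
def condMean (μ : Measure (ℕ → ℝ)) (A : Finset ℕ) (f : (ℕ → ℝ) → ℝ) : (ℕ → ℝ) → ℝ := fun x =>
  ∫ y, f (A.piecewise x y) ∂μ

lemma piecewise_update_of_mem {A : Finset ℕ} {k : ℕ} (h : k ∈ A) (x y : ℕ → ℝ) (c : ℝ) :
    A.piecewise (Function.update x k c) y = Function.update (A.piecewise x y) k c := by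
  funext i
  by_cases hi : i = k
  · subst hi; simp [h]
  · by_cases hA : i ∈ A <;> simp [hi, hA]

lemma piecewise_update_of_notMem {A : Finset ℕ} {k : ℕ} (h : k ∉ A) (x y : ℕ → ℝ) (c : ℝ) :
    A.piecewise (Function.update x k c) y = A.piecewise x y := by
  funext i
  by_cases hA : i ∈ A
  · have hi : i ≠ k := by rintro rfl; exact h hA
    simp [hi, hA]
  · simp [hA]

lemma piecewise_update_right {A : Finset ℕ} {k : ℕ} (h : k ∉ A) (x y : ℕ → ℝ) (c : ℝ) :
    A.piecewise x (Function.update y k c) = Function.update (A.piecewise x y) k c := by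
  funext i
  by_cases hi : i = k
  · subst hi; simp [h]
  · by_cases hA : i ∈ A <;> simp [hi, hA]

lemma free_condMean_of_notMem {μ : Measure (ℕ → ℝ)} {A : Finset ℕ} {k : ℕ} (h : k ∉ A)
    (f : (ℕ → ℝ) → ℝ) : Free k (condMean μ A f) := fun x c => by
  simp [condMean, piecewise_update_of_notMem h]

lemma Free.condMean {μ : Measure (ℕ → ℝ)} {A : Finset ℕ} {k : ℕ} {f : (ℕ → ℝ) → ℝ}
    (h : Free k f) : Free k (condMean μ A f) := fun x c => by
  by_cases hk : k ∈ A
  · simp only [Rademacher.condMean, piecewise_update_of_mem hk, h _ c]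
  · exact free_condMean_of_notMem hk f x c

lemma Free.condMean_insert {μ : Measure (ℕ → ℝ)} {A : Finset ℕ} {k : ℕ} {f : (ℕ → ℝ) → ℝ}
    (h : Free k f) : Rademacher.condMean μ (insert k A) f = Rademacher.condMean μ A f := by
  funext x
  simp only [Rademacher.condMean]
  congr 1 with y
  rw [Finset.piecewise_insert, h]

lemma measurable_condMean {μ : Measure (ℕ → ℝ)} [IsProbabilityMeasure μ] (A : Finset ℕ)
    {f : (ℕ → ℝ) → ℝ} (hf : Measurable f) : Measurable (condMean μ A f) :=
  ((hf.comp (measurable_piecewise_prod A)).stronglyMeasurable.integral_prod_right').measurable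

namespace IsRademacherLaw

variable {p : ℕ → ℝ} {μ : Measure (ℕ → ℝ)} [IsProbabilityMeasure μ] (hμ : IsRademacherLaw p μ)

include hμ

omit [IsProbabilityMeasure μ] in
lemma integrable_piecewise (A : Finset ℕ) {f : (ℕ → ℝ) → ℝ} (hf : Integrable f μ) :
    Integrable (fun z : (ℕ → ℝ) × (ℕ → ℝ) => f (A.piecewise z.1 z.2)) (μ.prod μ) :=
  (hμ.resample A).integrable_comp_of_integrable hf

lemma ae_integrable_piecewise (A : Finset ℕ) {f : (ℕ → ℝ) → ℝ} (hf : Integrable f μ) :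
    ∀ᵐ x ∂μ, Integrable (fun y => f (A.piecewise x y)) μ :=
  (hμ.integrable_piecewise A hf).prod_right_ae

lemma integrable_condMean (A : Finset ℕ) {f : (ℕ → ℝ) → ℝ} (hf : Integrable f μ) :
    Integrable (condMean μ A f) μ :=
  (hμ.integrable_piecewise A hf).integral_prod_left

lemma integral_condMean (A : Finset ℕ) {f : (ℕ → ℝ) → ℝ} (hf : Integrable f μ) :
    ∫ x, condMean μ A f x ∂μ = ∫ x, f x ∂μ := by
  have h := integral_prod _ (hμ.integrable_piecewise A hf)
  have h2 := integral_map (measurable_piecewise_prod A).aemeasurable (μ := μ.prod μ) (f := f)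
    (by rw [(hμ.resample A).map_eq]; exact hf.1)
  rw [(hμ.resample A).map_eq, h] at h2
  exact h2.symm

lemma lintegral_piecewise (A : Finset ℕ) {f : (ℕ → ℝ) → ℝ≥0∞} (hf : Measurable f) :
    ∫⁻ x, ∫⁻ y, f (A.piecewise x y) ∂μ ∂μ = ∫⁻ x, f x ∂μ := by
  rw [← lintegral_prod (fun z => f (A.piecewise z.1 z.2))
    (hf.comp (measurable_piecewise_prod A)).aemeasurable,
    (hμ.resample A).lintegral_comp hf]

lemma condMean_sub (A : Finset ℕ) {f g : (ℕ → ℝ) → ℝ} (hf : Integrable f μ)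
    (hg : Integrable g μ) :
    condMean μ A (fun x => f x - g x) =ᵐ[μ] fun x => condMean μ A f x - condMean μ A g x := by
  filter_upwards [hμ.ae_integrable_piecewise A hf, hμ.ae_integrable_piecewise A hg] with x h1 h2
  exact integral_sub h1 h2

lemma grad_condMean_of_mem {A : Finset ℕ} {l : ℕ} (hl : l ∈ A) {f : (ℕ → ℝ) → ℝ}
    (hf : Integrable f μ) : grad p l (condMean μ A f) =ᵐ[μ] condMean μ A (grad p l f) := by
  filter_upwards [hμ.ae_integrable_piecewise A (hμ.integrable_update hf l (.inl rfl)),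
    hμ.ae_integrable_piecewise A (hμ.integrable_update hf l (.inr rfl))] with x h1 h2
  simp only [grad, condMean, piecewise_update_of_mem hl]
  rw [integral_const_mul, integral_sub h1 h2]

lemma condMean_eq_mean {A : Finset ℕ} {k : ℕ} (hk : k ∉ A) {f : (ℕ → ℝ) → ℝ}
    (hf : Integrable f μ) : condMean μ A f =ᵐ[μ] condMean μ A (fun x =>
      p k * f (Function.update x k 1) + (1 - p k) * f (Function.update x k (-1))) := by
  filter_upwards [hμ.ae_integrable_piecewise A hf] with x h
  simp only [condMean]
  rw [hμ.integral_split h k]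
  simp only [piecewise_update_right hk]

/-- On the signs, `f` is its mean over coordinate `k` plus `Y_k D_k f`. Conditioning on `A ∪ {k}`
leaves `Y_k` outside the integral, and the mean part becomes the conditional mean given `A \ {k}`.
This increment is what telescopes in the covariance formula. -/
lemma normalized_mul_condMean_grad (A : Finset ℕ) (k : ℕ) {f : (ℕ → ℝ) → ℝ}
    (hf : Integrable f μ) : (fun x => normalized p k x * condMean μ A (grad p k f) x) =ᵐ[μ]
      fun x => condMean μ (insert k A) f x - condMean μ (A.erase k) f x := by
  set m : (ℕ → ℝ) → ℝ := fun x =>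
    p k * f (Function.update x k 1) + (1 - p k) * f (Function.update x k (-1)) with hm
  have hmf : Free k m := fun x c => by simp [hm]
  have hmi : Integrable m μ := ((hμ.integrable_update hf k (.inl rfl)).const_mul _).add
    ((hμ.integrable_update hf k (.inr rfl)).const_mul _)
  have h1 : condMean μ (A.erase k) m = condMean μ (insert k A) m := by
    rw [← hmf.condMean_insert (A := A.erase k)]
    congr 1
    ext i; by_cases i = k <;> simp [*]
  filter_upwards [hμ.condMean_eq_mean (A := A.erase k) (Finset.notMem_erase k A) hf, hμ.ae_sign k,
    hμ.condMean_sub (insert k A) hf hmi] with x hx hs h2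
  rw [hx, h1, ← h2, ← (free_grad p k f).condMean_insert, condMean, condMean, ← integral_const_mul]
  congr 1 with y
  have hk : (insert k A).piecewise x y k = x k := by simp
  have := hμ.eq_mean_add (f := f) (k := k) (x := (insert k A).piecewise x y) (by rwa [hk])
  have hn : normalized p k ((insert k A).piecewise x y) = normalized p k x := by
    simp [normalized]
  rw [hn] at this
  simp only [hm]
  rw [eq_sub_iff_add_eq, add_comm]
  exact this.symm

lemma memLp_condMean (A : Finset ℕ) {f : (ℕ → ℝ) → ℝ} (hfm : Measurable f) (hf : MemLp f 2 μ) :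
    MemLp (condMean μ A f) 2 μ ∧
      ∫⁻ x, ‖condMean μ A f x‖ₑ ^ 2 ∂μ ≤ ∫⁻ x, ‖f x‖ₑ ^ 2 ∂μ := by
  have key : ∫⁻ x, ‖condMean μ A f x‖ₑ ^ 2 ∂μ ≤ ∫⁻ x, ‖f x‖ₑ ^ 2 ∂μ := by
    rw [← hμ.lintegral_piecewise A (hfm.enorm.pow_const 2)]
    refine lintegral_mono fun x => ?_
    have hmeas : Measurable fun y => f (A.piecewise x y) :=
      hfm.comp ((measurable_piecewise_prod A).comp measurable_prodMk_left)
    have h1 : ‖condMean μ A f x‖ₑ ≤ ∫⁻ y, ‖f (A.piecewise x y)‖ₑ ∂μ :=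
      enorm_integral_le_lintegral_enorm _
    have h2 := ENNReal.lintegral_mul_le_Lp_mul_Lq μ (p := 2) (q := 2)
      Real.HolderConjugate.two_two (f := fun y => ‖f (A.piecewise x y)‖ₑ) (g := fun _ => 1)
      hmeas.enorm.aemeasurable aemeasurable_const
    simp only [Pi.mul_apply, mul_one, ENNReal.one_rpow, lintegral_const, measure_univ] at h2
    calc ‖condMean μ A f x‖ₑ ^ 2 ≤ ((∫⁻ y, ‖f (A.piecewise x y)‖ₑ ^ (2 : ℝ) ∂μ) ^ (1 / 2 : ℝ)) ^ 2 := by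
          gcongr; exact h1.trans h2
      _ = ∫⁻ y, ‖f (A.piecewise x y)‖ₑ ^ (2 : ℝ) ∂μ := by
          rw [← ENNReal.rpow_natCast, ← ENNReal.rpow_mul]; norm_num
      _ = _ := by norm_num
  refine ⟨⟨(measurable_condMean A hfm).aestronglyMeasurable, ?_⟩, key⟩
  rw [eLpNorm_lt_top_iff_lintegral_rpow_enorm_lt_top (by norm_num) (by norm_num)]
  have := (eLpNorm_lt_top_iff_lintegral_rpow_enorm_lt_top (by norm_num) (by norm_num)).1 hf.2
  norm_num at this ⊢
  exact key.trans_lt this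

/-- Conditional means are symmetric. -/
lemma integral_mul_condMean_comm (A : Finset ℕ) {f g : (ℕ → ℝ) → ℝ} (hfm : Measurable f)
    (hf : MemLp f 2 μ) (hg : MemLp g 2 μ) :
    ∫ x, g x * condMean μ A f x ∂μ = ∫ x, condMean μ A g x * condMean μ A f x ∂μ := by
  have hi : Integrable (fun x => g x * condMean μ A f x) μ :=
    hg.integrable_mul (hμ.memLp_condMean A hfm hf).1
  rw [← hμ.integral_condMean A hi]
  congr 1 with x
  simp only [condMean]
  rw [← integral_mul_const]
  congr 1 with y
  have : ∀ y', A.piecewise (A.piecewise x y) y' = A.piecewise x y' := fun y' => by simp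
  simp only [this]

end IsRademacherLaw

/-! ### Random subsets of uniform cardinality. -/

/-- The law of a random subset of `{0, …, n-1}` of uniformly distributed cardinality. -/
def subsetWeight (n : ℕ) (A : Finset ℕ) : ℝ :=
  (A.card.factorial : ℝ) * ((n - A.card).factorial : ℝ) / ((n + 1).factorial : ℝ)

lemma subsetWeight_nonneg (n : ℕ) (A : Finset ℕ) : 0 ≤ subsetWeight n A := by
  unfold subsetWeight; positivity

lemma sum_subsetWeight (n : ℕ) : ∑ A ∈ (Finset.range n).powerset, subsetWeight n A = 1 := by
  unfold subsetWeight
  rw [Finset.sum_powerset_apply_card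
    (fun m => (m.factorial : ℝ) * ((n - m).factorial : ℝ) / ((n + 1).factorial : ℝ)),
    Finset.card_range]
  have : ∀ m ∈ Finset.range (n + 1), n.choose m •
      ((m.factorial : ℝ) * ((n - m).factorial : ℝ) / ((n + 1).factorial : ℝ)) = 1 / (n + 1) := by
    intro m hm
    have h := Nat.choose_mul_factorial_mul_factorial (Nat.lt_succ_iff.1 (Finset.mem_range.1 hm))
    have h' : (n.choose m : ℝ) * m.factorial * (n - m).factorial = n.factorial := by
      exact_mod_cast h
    rw [nsmul_eq_mul, Nat.factorial_succ, ← mul_div_assoc, ← mul_assoc, h']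
    have := Nat.factorial_pos n
    push_cast
    field_simp
  rw [Finset.sum_congr rfl this]
  simp
  field_simp

/-- Complementation preserves the weight and exchanges the sets that contain `l` with those that do
not. The value `1 / 2` is the source of the factor `1 / 4` in the variance bound for the Stein
kernel. -/
lemma sum_subsetWeight_mem {n l : ℕ} (hl : l < n) :
    ∑ A ∈ (Finset.range n).powerset with l ∈ A, subsetWeight n A = 1 / 2 := by
  have h : ∑ A ∈ (Finset.range n).powerset with l ∈ A, subsetWeight n A =
      ∑ A ∈ (Finset.range n).powerset with l ∉ A, subsetWeight n A := by
    refine Finset.sum_nbij' (Finset.range n \ ·) (Finset.range n \ ·) ?_ ?_ ?_ ?_ ?_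
    · intro A hA
      simp_all
    · intro A hA
      simp_all
    · intro A hA
      simp only [Finset.mem_filter, Finset.mem_powerset] at hA
      simp [hA.1]
    · intro A hA
      simp only [Finset.mem_filter, Finset.mem_powerset] at hA
      simp [hA.1]
    · intro A hA
      simp only [Finset.mem_filter, Finset.mem_powerset] at hA
      have h1 := Finset.card_sdiff_of_subset hA.1
      have h2 := Finset.card_le_card hA.1
      rw [Finset.card_range] at h1 h2
      simp only [subsetWeight, h1]
      rw [Nat.sub_sub_self h2, mul_comm (A.card.factorial : ℝ)]
  have h2 := Finset.sum_filter_add_sum_filter_not (Finset.range n).powerset (fun A => l ∈ A)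
    (subsetWeight n)
  rw [sum_subsetWeight] at h2
  linarith

lemma sum_subsetWeight_mem_le (n l : ℕ) :
    ∑ A ∈ (Finset.range n).powerset with l ∈ A, subsetWeight n A ≤ 1 / 2 := by
  by_cases hl : l < n
  · exact (sum_subsetWeight_mem hl).le
  · rw [Finset.sum_eq_zero]
    · norm_num
    · intro A hA
      simp only [Finset.mem_filter, Finset.mem_powerset] at hA
      exact absurd (Finset.mem_range.1 (hA.1 hA.2)) hl

/-- Collects the coefficient of each `c B`. If `k ∈ B`, then `insert k A = B` for `A = B` and `A = B
\ {k}`, whose weights add up to `(|B|-1)! (n-|B|)! / n!`; the case `k ∉ B` is analogous with `B` and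
`B ∪ {k}`. -/
lemma sum_subsetWeight_insert_sub_erase {n k : ℕ} (hk : k < n) (c : Finset ℕ → ℝ) :
    ∑ A ∈ (Finset.range n).powerset, subsetWeight n A * (c (insert k A) - c (A.erase k)) =
      ∑ B ∈ (Finset.range n).powerset, (if k ∈ B then (B.card.factorial : ℝ) *
        ((n - B.card).factorial : ℝ) / (n.factorial : ℝ) / B.card * c B else 0) -
      ∑ B ∈ (Finset.range n).powerset, (if k ∉ B then (B.card.factorial : ℝ) *
        ((n - B.card).factorial : ℝ) / (n.factorial : ℝ) / (n - B.card : ℝ) * c B else 0) := by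
  have hN : Finset.range n = insert k ((Finset.range n).erase k) :=
    (Finset.insert_erase (Finset.mem_range.2 hk)).symm
  have hk' : k ∉ (Finset.range n).erase k := Finset.notMem_erase _ _
  rw [hN, Finset.sum_powerset_insert hk', Finset.sum_powerset_insert hk',
    Finset.sum_powerset_insert hk', ← Finset.sum_add_distrib, ← Finset.sum_add_distrib,
    ← Finset.sum_add_distrib, ← Finset.sum_sub_distrib]
  refine Finset.sum_congr rfl fun A hA => ?_
  have hsub := Finset.mem_powerset.1 hA
  have hkA : k ∉ A := fun h => hk' (hsub h)
  have hcard : A.card ≤ n - 1 := by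
    have := Finset.card_le_card hsub
    rwa [Finset.card_erase_of_mem (Finset.mem_range.2 hk), Finset.card_range] at this
  obtain ⟨b, hb⟩ : ∃ b, n = A.card + b + 1 := ⟨n - 1 - A.card, by omega⟩
  rw [Finset.erase_insert hkA, Finset.erase_eq_of_notMem hkA, Finset.insert_idem, if_neg hkA,
    if_pos (Finset.mem_insert_self k A), if_pos hkA,
    if_neg (not_not.2 (Finset.mem_insert_self k A)), subsetWeight, subsetWeight,
    Finset.card_insert_of_notMem hkA]
  have e1 : n - A.card = b + 1 := by omega
  have e2 : n - (A.card + 1) = b := by omega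
  have e3 : (n : ℝ) = A.card + b + 1 := by exact_mod_cast hb
  have hf : (n.factorial : ℝ) ≠ 0 := by positivity
  rw [e1, e2, Nat.factorial_succ n, Nat.factorial_succ b, Nat.factorial_succ A.card]
  push_cast
  clear hN
  have h1 : ((A.card : ℝ) + 1) ≠ 0 := Nat.cast_add_one_ne_zero _
  have h2 : ((b : ℝ) + 1) ≠ 0 := Nat.cast_add_one_ne_zero _
  have h3 : ((n : ℝ) + 1) ≠ 0 := Nat.cast_add_one_ne_zero _
  have h4 : (n : ℝ) - A.card = b + 1 := by rw [e3]; ring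
  rw [h4]
  field_simp
  rw [e3]
  ring

/-- The telescoping identity behind the covariance formula. -/
lemma sum_sum_subsetWeight (n : ℕ) (c : Finset ℕ → ℝ) :
    ∑ k ∈ Finset.range n, ∑ A ∈ (Finset.range n).powerset,
      subsetWeight n A * (c (insert k A) - c (A.erase k)) = c (Finset.range n) - c ∅ := by
  rw [Finset.sum_congr rfl fun k hk =>
    sum_subsetWeight_insert_sub_erase (Finset.mem_range.1 hk) c, Finset.sum_sub_distrib,
    Finset.sum_comm, Finset.sum_comm (s := Finset.range n), ← Finset.sum_sub_distrib]
  -- The `|B|` indices in `B` each carry a factor `1/|B|`, and the `n - |B|` others a factor `1/(n -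
  -- |B|)`, so the two sums cancel. Only `B = ∅` and the full set survive, where one of the sums is
  -- empty.
  have key : ∀ B ∈ (Finset.range n).powerset,
      ((∑ k ∈ Finset.range n, if k ∈ B then (B.card.factorial : ℝ) *
        ((n - B.card).factorial : ℝ) / (n.factorial : ℝ) / B.card * c B else 0) -
      ∑ k ∈ Finset.range n, if k ∉ B then (B.card.factorial : ℝ) *
        ((n - B.card).factorial : ℝ) / (n.factorial : ℝ) / (n - B.card : ℝ) * c B else 0) =
      (if B = Finset.range n then c B else 0) - (if B = ∅ then c B else 0) := by
    intro B hB
    have hsub := Finset.mem_powerset.1 hB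
    have hle : B.card ≤ n := by simpa using Finset.card_le_card hsub
    have hf : (n.factorial : ℝ) ≠ 0 := by positivity
    rw [← Finset.sum_filter, ← Finset.sum_filter, Finset.filter_mem_eq_inter,
      Finset.inter_eq_right.2 hsub, Finset.filter_notMem_eq_sdiff, Finset.sum_const,
      Finset.sum_const, Finset.card_sdiff_of_subset hsub, Finset.card_range, nsmul_eq_mul,
      nsmul_eq_mul, Nat.cast_sub hle]
    have hE : B = ∅ ↔ B.card = 0 := Finset.card_eq_zero.symm
    have hR : B = Finset.range n ↔ B.card = n := by
      constructor
      · rintro rfl; simp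
      · intro h; exact Finset.eq_of_subset_of_card_le hsub (by simp [h])
    simp only [hE, hR]
    by_cases h0 : B.card = 0 <;> by_cases h1 : B.card = n
    · have h2 : n = 0 := by omega
      simp [h0, h2]
    · have : (n : ℝ) ≠ 0 := by simp; omega
      rw [if_neg h1, if_pos h0]
      simp only [h0, Nat.cast_zero, zero_mul, sub_zero, Nat.factorial_zero, Nat.cast_one, one_mul,
        Nat.sub_zero]
      field_simp
    · rw [if_pos h1, if_neg h0, h1]
      have : (n : ℝ) ≠ 0 := by simp; omega
      simp only [sub_self, zero_mul, sub_zero, Nat.sub_self, Nat.factorial_zero, Nat.cast_one,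
        mul_one]
      field_simp
    · rw [if_neg h0, if_neg h1]
      have a1 : (B.card : ℝ) ≠ 0 := by exact_mod_cast h0
      have a2 : (n : ℝ) - B.card ≠ 0 := by
        rw [sub_ne_zero]; exact_mod_cast Ne.symm h1
      field_simp
      ring
  rw [Finset.sum_congr rfl key, Finset.sum_sub_distrib]
  simp

/-! ### Square roots and Cauchy–Schwarz in `[0, ∞]`. -/

lemma esqrt_le_esqrt {a b : ℝ≥0∞} (h : a ≤ b) : esqrt a ≤ esqrt b :=
  ENNReal.rpow_le_rpow h (by norm_num)

lemma esqrt_sq (a : ℝ≥0∞) : esqrt a ^ 2 = a := by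
  rw [esqrt, ← ENNReal.rpow_natCast, ← ENNReal.rpow_mul]; norm_num

lemma esqrt_mul_self (a : ℝ≥0∞) : esqrt a * esqrt a = a := by rw [← sq, esqrt_sq]

lemma le_esqrt {a b : ℝ≥0∞} (h : a ^ 2 ≤ b) : a ≤ esqrt b := by
  refine le_trans (le_of_eq ?_) (esqrt_le_esqrt h)
  rw [esqrt, ← ENNReal.rpow_natCast, ← ENNReal.rpow_mul]; norm_num

lemma esqrt_mul (a b : ℝ≥0∞) : esqrt (a * b) = esqrt a * esqrt b :=
  ENNReal.mul_rpow_of_nonneg _ _ (by norm_num)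

lemma esqrt_add_le (a b : ℝ≥0∞) : esqrt (a + b) ≤ esqrt a + esqrt b :=
  ENNReal.rpow_add_le_add_rpow _ _ (by norm_num) (by norm_num)

lemma esqrt_top : esqrt ∞ = ∞ := by simp [esqrt]

lemma esqrt_ofReal {a : ℝ} (ha : 0 ≤ a) : esqrt (ENNReal.ofReal a) = ENNReal.ofReal √a := by
  rw [esqrt, ENNReal.ofReal_rpow_of_nonneg ha (by norm_num), Real.sqrt_eq_rpow]

section

variable {α : Type*} [MeasurableSpace α] {μ : Measure α}

lemma lintegral_enorm_sq {g : α → ℝ} (hg : MemLp g 2 μ) :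
    ∫⁻ x, ‖g x‖ₑ ^ 2 ∂μ = ENNReal.ofReal (∫ x, g x ^ 2 ∂μ) := by
  rw [ofReal_integral_eq_lintegral_ofReal hg.integrable_sq (.of_forall fun x => sq_nonneg _)]
  congr 1 with x
  rw [Real.enorm_eq_ofReal_abs, ← ENNReal.ofReal_pow (abs_nonneg _), sq_abs]

lemma memLp_two_iff {g : α → ℝ} (hg : AEStronglyMeasurable g μ) :
    MemLp g 2 μ ↔ ∫⁻ x, ‖g x‖ₑ ^ 2 ∂μ < ∞ := by
  rw [MemLp, eLpNorm_lt_top_iff_lintegral_rpow_enorm_lt_top (by norm_num) (by norm_num)]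
  norm_num [hg]

lemma memLp_four_iff {g : α → ℝ} (hg : AEStronglyMeasurable g μ) :
    MemLp g 4 μ ↔ ∫⁻ x, ‖g x‖ₑ ^ 4 ∂μ < ∞ := by
  rw [MemLp, eLpNorm_lt_top_iff_lintegral_rpow_enorm_lt_top (by norm_num) (by norm_num)]
  norm_num [hg]

lemma lintegral_mul_le_esqrt {f g : α → ℝ≥0∞} (hf : AEMeasurable f μ) (hg : AEMeasurable g μ) :
    ∫⁻ x, f x * g x ∂μ ≤ esqrt (∫⁻ x, f x ^ 2 ∂μ) * esqrt (∫⁻ x, g x ^ 2 ∂μ) := by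
  have h := ENNReal.lintegral_mul_le_Lp_mul_Lq μ Real.HolderConjugate.two_two hf hg
  simpa [esqrt] using h

lemma lintegral_sq_le [IsProbabilityMeasure μ] {f : α → ℝ≥0∞} (hf : AEMeasurable f μ) :
    (∫⁻ x, f x ∂μ) ^ 2 ≤ ∫⁻ x, f x ^ 2 ∂μ := by
  have h := lintegral_mul_le_esqrt hf (aemeasurable_const (b := (1 : ℝ≥0∞)))
  have h1 : esqrt 1 = 1 := by simp [esqrt]
  simp only [mul_one, one_pow, lintegral_const, measure_univ, h1] at h
  calc _ ≤ esqrt (∫⁻ x, f x ^ 2 ∂μ) ^ 2 := by gcongr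
    _ = _ := esqrt_sq _

lemma integrable_fun_mul {f g : α → ℝ} (hf : MemLp f 2 μ) (hg : MemLp g 2 μ) :
    Integrable (fun x => f x * g x) μ := hf.integrable_mul hg

lemma abs_integral_mul_le {f g : α → ℝ} (hf : MemLp f 2 μ) (hg : MemLp g 2 μ) :
    |∫ x, f x * g x ∂μ| ≤ √(∫ x, f x ^ 2 ∂μ) * √(∫ x, g x ^ 2 ∂μ) := by
  have h2 : ENNReal.ofReal 2 = 2 := by norm_num
  have h := integral_mul_norm_le_Lp_mul_Lq (μ := μ) (f := f) (g := g) Real.HolderConjugate.two_two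
    (by rwa [h2]) (by rwa [h2])
  refine (abs_integral_le_integral_abs).trans ?_
  simpa [abs_mul, Real.sqrt_eq_rpow] using h

end

/-! ### Covariance formula, martingale convergence and the Poincaré inequality. -/

/-- The average of the conditional means over a random subset of `{0, …, n-1}`. -/
def mixMean (μ : Measure (ℕ → ℝ)) (n : ℕ) (f : (ℕ → ℝ) → ℝ) : (ℕ → ℝ) → ℝ := fun x =>
  ∑ A ∈ (Finset.range n).powerset, subsetWeight n A * condMean μ A f x

/-- The filtration generated by the coordinates `0, …, n-1`. -/
def coordFiltration : Filtration ℕ (MeasurableSpace.pi : MeasurableSpace (ℕ → ℝ)) where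
  seq n := Filtration.piFinset (X := fun _ : ℕ => ℝ) (Finset.range n)
  mono' _ _ h := (Filtration.piFinset (X := fun _ : ℕ => ℝ)).mono (Finset.range_mono h)
  le' n := (Filtration.piFinset (X := fun _ : ℕ => ℝ)).le (Finset.range n)

lemma coordFiltration_apply (n : ℕ) :
    (coordFiltration n : MeasurableSpace (ℕ → ℝ)) =
      MeasurableSpace.comap (fun (x : ℕ → ℝ) (i : Finset.range n) => x i) MeasurableSpace.pi := rfl

lemma iSup_coordFiltration :
    (⨆ n, coordFiltration n : MeasurableSpace (ℕ → ℝ)) = MeasurableSpace.pi := by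
  refine le_antisymm (iSup_le fun n => coordFiltration.le n) (iSup_le fun k => ?_)
  refine le_trans ?_ (le_iSup (fun n => (coordFiltration n : MeasurableSpace (ℕ → ℝ))) (k + 1))
  rw [coordFiltration_apply, ← measurable_iff_comap_le]
  have : (fun x : ℕ → ℝ => x k) =
    (fun z : Finset.range (k + 1) → ℝ => z ⟨k, by simp⟩) ∘ (fun x i => x i) := rfl
  rw [this]
  exact (measurable_pi_apply _).comp (comap_measurable _)

lemma condMean_empty (μ : Measure (ℕ → ℝ)) (f : (ℕ → ℝ) → ℝ) (x : ℕ → ℝ) :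
    condMean μ ∅ f x = ∫ y, f y ∂μ := by simp [condMean]

namespace IsRademacherLaw

variable {p : ℕ → ℝ} {μ : Measure (ℕ → ℝ)} [IsProbabilityMeasure μ] (hμ : IsRademacherLaw p μ)

include hμ

lemma memLp_mixMean (n : ℕ) {f : (ℕ → ℝ) → ℝ} (hfm : Measurable f) (hf : MemLp f 2 μ) :
    MemLp (mixMean μ n f) 2 μ :=
  memLp_finsetSum _ fun A _ => (hμ.memLp_condMean A hfm hf).1.const_mul _

lemma integral_condMean_sq_le (A : Finset ℕ) {f : (ℕ → ℝ) → ℝ} (hfm : Measurable f)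
    (hf : MemLp f 2 μ) : ∫ x, condMean μ A f x ^ 2 ∂μ ≤ ∫ x, f x ^ 2 ∂μ := by
  have h := hμ.memLp_condMean A hfm hf
  have h2 := h.2
  rw [lintegral_enorm_sq h.1, lintegral_enorm_sq hf] at h2
  exact (ENNReal.ofReal_le_ofReal_iff (integral_nonneg fun x => sq_nonneg _)).1 h2

/-- The covariance formula. -/
lemma covariance_formula (n : ℕ) {f g : (ℕ → ℝ) → ℝ} (hfm : Measurable f) (hf : MemLp f 2 μ)
    (hg : MemLp g 2 μ) :
    ∫ x, g x * condMean μ (Finset.range n) f x ∂μ - (∫ x, g x ∂μ) * ∫ x, f x ∂μ =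
      ∑ k ∈ Finset.range n, ∫ x, grad p k g x * mixMean μ n (grad p k f) x ∂μ := by
  have hfi := hf.integrable (by norm_num)
  have hG (k : ℕ) (A : Finset ℕ) := (hμ.memLp_condMean A (measurable_grad (k := k) hfm)
    (hμ.memLp_grad hf k)).1
  have hC (A : Finset ℕ) := (hμ.memLp_condMean A hfm hf).1
  have h := sum_sum_subsetWeight n (fun A => ∫ x, g x * condMean μ A f x ∂μ)
  simp only [condMean_empty, integral_mul_const] at h
  rw [← h]
  refine Finset.sum_congr rfl fun k _ => ?_
  simp only [mixMean, Finset.mul_sum, mul_left_comm _ (subsetWeight _ _)]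
  rw [integral_finsetSum]
  · refine Finset.sum_congr rfl fun A _ => ?_
    rw [integral_const_mul, hμ.integral_grad_mul (free_grad p k f).condMean
      (integrable_fun_mul hg (hG k A)), ← integral_sub (integrable_fun_mul hg (hC _))
      (integrable_fun_mul hg (hC _))]
    congr 1
    refine integral_congr_ae ?_
    filter_upwards [hμ.normalized_mul_condMean_grad A k hfi] with x hx
    rw [hx, mul_sub]
  · exact fun A _ => (integrable_fun_mul (hμ.memLp_grad hg k) (hG k A)).const_mul _

lemma condMean_ae_eq_condExp (n : ℕ) {f : (ℕ → ℝ) → ℝ} (hfm : Measurable f)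
    (hf : Integrable f μ) :
    condMean μ (Finset.range n) f =ᵐ[μ] μ[f | coordFiltration n] := by
  refine ae_eq_condExp_of_forall_setIntegral_eq (coordFiltration.le n) hf
    (fun s _ _ => (hμ.integrable_condMean _ hf).integrableOn) (fun s hs _ => ?_) ?_
  · have hs' := coordFiltration.le n s hs
    obtain ⟨B, hB, rfl⟩ := hs
    rw [← integral_indicator hs', ← integral_indicator hs',
      ← hμ.integral_condMean (Finset.range n) (hf.indicator hs')]
    congr 1 with x
    by_cases hx : x ∈ (Finset.range n).restrict ⁻¹' B
    · rw [Set.indicator_of_mem hx]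
      simp only [condMean]
      congr 1 with y
      rw [Set.indicator_of_mem]
      have : (Finset.range n).restrict ((Finset.range n).piecewise x y) =
        (Finset.range n).restrict (π := fun _ => ℝ) x := by
        ext i
        exact Finset.piecewise_eq_of_mem _ _ _ i.2
      simpa only [Set.mem_preimage, this] using hx
    · rw [Set.indicator_of_notMem hx]
      simp only [condMean]
      symm
      refine integral_eq_zero_of_ae (.of_forall fun y => ?_)
      refine Set.indicator_of_notMem ?_ _
      have : (Finset.range n).restrict ((Finset.range n).piecewise x y) =
        (Finset.range n).restrict (π := fun _ => ℝ) x := by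
        ext i
        exact Finset.piecewise_eq_of_mem _ _ _ i.2
      simpa only [Set.mem_preimage, this] using hx
  · refine Measurable.aestronglyMeasurable ?_
    set e : (Finset.range n → ℝ) → (ℕ → ℝ) := fun z i =>
      if h : i ∈ Finset.range n then z ⟨i, h⟩ else 0 with he
    have hem : Measurable e := measurable_pi_lambda _ fun i => by
      by_cases h : i ∈ Finset.range n
      · simp only [he, h, dif_pos]; fun_prop
      · simp only [he, h, dif_neg, not_false_eq_true]; fun_prop
    have : condMean μ (Finset.range n) f = (fun z => condMean μ (Finset.range n) f (e z)) ∘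
        (fun (x : ℕ → ℝ) (i : Finset.range n) => x i) := by
      funext x
      simp only [condMean, Function.comp]
      congr 1 with y
      congr 1
      funext i
      by_cases h : i ∈ Finset.range n
      · rw [Finset.piecewise_eq_of_mem _ _ _ h, Finset.piecewise_eq_of_mem _ _ _ h, he]
        simp [h]
      · rw [Finset.piecewise_eq_of_notMem _ _ _ h, Finset.piecewise_eq_of_notMem _ _ _ h]
    rw [this]
    exact ((measurable_condMean _ hfm).comp hem).comp (comap_measurable _)

/-- Lévy's upward theorem gives almost sure convergence. The second moments converge as well: they
are at most that of `f` by contraction, and Fatou's lemma gives the reverse bound. Since conditional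
means are orthogonal projections, the squared distance is the difference of the second moments. -/
lemma tendsto_integral_sub_condMean_sq {f : (ℕ → ℝ) → ℝ} (hfm : Measurable f)
    (hf : MemLp f 2 μ) : Filter.Tendsto
      (fun n => ∫ x, (f x - condMean μ (Finset.range n) f x) ^ 2 ∂μ) Filter.atTop (nhds 0) := by
  have hfi := hf.integrable (by norm_num)
  have hC (n : ℕ) := hμ.memLp_condMean (Finset.range n) hfm hf
  have hae : ∀ᵐ x ∂μ, Filter.Tendsto (fun n => condMean μ (Finset.range n) f x) Filter.atTop
      (nhds (f x)) := by
    have h1 := tendsto_ae_condExp (μ := μ) (ℱ := coordFiltration) f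
    have h2 : ∀ᵐ x ∂μ, ∀ n, condMean μ (Finset.range n) f x = (μ[f | coordFiltration n]) x :=
      ae_all_iff.2 fun n => hμ.condMean_ae_eq_condExp n hfm hfi
    have h3 : μ[f | ⨆ n, coordFiltration n] = f := by
      rw [iSup_coordFiltration]
      exact condExp_of_stronglyMeasurable le_rfl hfm.stronglyMeasurable hfi
    filter_upwards [h1, h2] with x h1 h2
    rw [h3] at h1
    simpa only [h2] using h1
  have hlim : Filter.Tendsto (fun n => ∫⁻ x, ‖condMean μ (Finset.range n) f x‖ₑ ^ 2 ∂μ)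
      Filter.atTop (nhds (∫⁻ x, ‖f x‖ₑ ^ 2 ∂μ)) := by
    refine tendsto_of_le_liminf_of_limsup_le ?_
      (Filter.limsup_le_of_le (h := .of_forall fun n => (hC n).2))
    refine le_trans (le_of_eq ?_) (lintegral_liminf_le fun n =>
      (measurable_condMean (Finset.range n) hfm).enorm.pow_const 2)
    refine lintegral_congr_ae ?_
    filter_upwards [hae] with x hx
    exact (((ENNReal.continuous_pow 2).comp continuous_enorm).tendsto _ |>.comp hx).liminf_eq.symm
  simp only [lintegral_enorm_sq hf, fun n => lintegral_enorm_sq (hC n).1] at hlim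
  have hlim' := (ENNReal.tendsto_toReal ENNReal.ofReal_ne_top).comp hlim
  simp only [Function.comp_def, ENNReal.toReal_ofReal (integral_nonneg fun x => sq_nonneg (f x)),
    fun n => ENNReal.toReal_ofReal (integral_nonneg (μ := μ) fun x =>
      sq_nonneg (condMean μ (Finset.range n) f x))] at hlim'
  have := hlim'.const_sub (∫ x, f x ^ 2 ∂μ)
  rw [sub_self] at this
  refine this.congr fun n => ?_
  have hs := hμ.integral_mul_condMean_comm (Finset.range n) hfm hf hf
  simp only [← sq] at hs
  have e : ∀ x, (f x - condMean μ (Finset.range n) f x) ^ 2 = f x ^ 2 -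
      2 * (f x * condMean μ (Finset.range n) f x) + condMean μ (Finset.range n) f x ^ 2 :=
    fun x => by ring
  simp only [e]
  have i1 := hf.integrable_sq
  have i2 : Integrable (fun x => 2 * (f x * condMean μ (Finset.range n) f x)) μ :=
    (integrable_fun_mul hf (hC n).1).const_mul 2
  have i3 : Integrable (fun x => f x ^ 2 - 2 * (f x * condMean μ (Finset.range n) f x)) μ :=
    i1.sub i2
  rw [integral_add i3 (hC n).1.integrable_sq, integral_sub i1 i2, integral_const_mul, hs]
  ring

lemma tendsto_integral_mul_condMean {f g : (ℕ → ℝ) → ℝ} (hfm : Measurable f)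
    (hf : MemLp f 2 μ) (hg : MemLp g 2 μ) : Filter.Tendsto
      (fun n => ∫ x, g x * condMean μ (Finset.range n) f x ∂μ) Filter.atTop
      (nhds (∫ x, g x * f x ∂μ)) := by
  have h := (hμ.tendsto_integral_sub_condMean_sq hfm hf).sqrt.const_mul (√(∫ x, g x ^ 2 ∂μ))
  rw [Real.sqrt_zero, mul_zero] at h
  rw [tendsto_iff_norm_sub_tendsto_zero]
  refine squeeze_zero (fun _ => norm_nonneg _) (fun n => ?_) h
  have hC := (hμ.memLp_condMean (Finset.range n) hfm hf).1
  rw [← integral_sub (integrable_fun_mul hg hC) (integrable_fun_mul hg hf), Real.norm_eq_abs, ← abs_neg,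
    ← integral_neg]
  refine le_trans (le_of_eq ?_) (abs_integral_mul_le hg (hf.sub hC))
  congr 2 with x
  ring

/-- Each conditional mean is a symmetric idempotent contraction of `L²`, and the weights sum to one.
-/
lemma integral_mul_mixMean_le (n : ℕ) {f : (ℕ → ℝ) → ℝ} (hfm : Measurable f)
    (hf : MemLp f 2 μ) :
    ∫ x, f x * mixMean μ n f x ∂μ ≤ ∫ x, f x ^ 2 ∂μ := by
  have hC (A : Finset ℕ) := (hμ.memLp_condMean A hfm hf).1
  simp only [mixMean, Finset.mul_sum, mul_left_comm _ (subsetWeight _ _)]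
  rw [integral_finsetSum _ fun A _ => (integrable_fun_mul hf (hC A)).const_mul _]
  calc _ ≤ ∑ A ∈ (Finset.range n).powerset, subsetWeight n A * ∫ x, f x ^ 2 ∂μ := by
        refine Finset.sum_le_sum fun A _ => ?_
        rw [integral_const_mul]
        refine mul_le_mul_of_nonneg_left ?_ (subsetWeight_nonneg n A)
        rw [hμ.integral_mul_condMean_comm A hfm hf hf]
        simp only [← sq]
        exact hμ.integral_condMean_sq_le A hfm hf
    _ = _ := by rw [← Finset.sum_mul, sum_subsetWeight, one_mul]

/-- The Poincaré inequality, for the mean absolute deviation. -/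
lemma lintegral_enorm_sub_mean_le {f : (ℕ → ℝ) → ℝ} (hfm : Measurable f) (hf : MemLp f 2 μ) :
    ∫⁻ x, ‖f x - ∫ y, f y ∂μ‖ₑ ∂μ ≤ esqrt (∑' l, ∫⁻ x, ‖grad p l f x‖ₑ ^ 2 ∂μ) := by
  by_cases hV : ∑' l, ∫⁻ x, ‖grad p l f x‖ₑ ^ 2 ∂μ = ∞
  · rw [hV, esqrt_top]; exact le_top
  have hc : MemLp (fun x => f x - ∫ y, f y ∂μ) 2 μ := hf.sub (memLp_const _)
  refine le_esqrt ((lintegral_sq_le hc.1.enorm).trans ?_)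
  rw [lintegral_enorm_sq hc, ← ENNReal.ofReal_toReal hV]
  refine ENNReal.ofReal_le_ofReal ?_
  have e : ∫ x, (f x - ∫ y, f y ∂μ) ^ 2 ∂μ =
      ∫ x, f x * f x ∂μ - (∫ x, f x ∂μ) * ∫ x, f x ∂μ := by
    have hfi := hf.integrable (by norm_num)
    have e1 : ∀ x, (f x - ∫ y, f y ∂μ) ^ 2 = f x * f x -
      2 * (∫ y, f y ∂μ) * f x + (∫ y, f y ∂μ) ^ 2 := fun x => by ring
    simp only [e1]
    have i3 : Integrable (fun x => f x * f x - 2 * (∫ y, f y ∂μ) * f x) μ :=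
      (integrable_fun_mul hf hf).sub (hfi.const_mul _)
    rw [integral_add i3 (integrable_const _),
      integral_sub (integrable_fun_mul hf hf) (hfi.const_mul _), integral_const_mul, integral_const]
    simp
    ring
  rw [e]
  -- The variance is the limit of the covariance formula with `g = f`, whose `k`-th term is at most
  -- `E[(D_k f)²]`.
  refine le_of_tendsto ((hμ.tendsto_integral_mul_condMean hfm hf hf).sub_const _)
    (.of_forall fun n => ?_)
  rw [hμ.covariance_formula n hfm hf hf]
  calc _ ≤ ∑ k ∈ Finset.range n, ∫ x, grad p k f x ^ 2 ∂μ := Finset.sum_le_sum fun k _ =>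
        hμ.integral_mul_mixMean_le n (measurable_grad hfm) (hμ.memLp_grad hf k)
    _ = (∑ k ∈ Finset.range n, ∫⁻ x, ‖grad p k f x‖ₑ ^ 2 ∂μ).toReal := by
        rw [ENNReal.toReal_sum fun k _ => by
          rw [lintegral_enorm_sq (hμ.memLp_grad hf k)]; exact ENNReal.ofReal_ne_top]
        refine Finset.sum_congr rfl fun k _ => ?_
        rw [lintegral_enorm_sq (hμ.memLp_grad hf k),
          ENNReal.toReal_ofReal (integral_nonneg fun x => sq_nonneg _)]
    _ ≤ _ := ENNReal.toReal_mono hV (ENNReal.sum_le_tsum _)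

end IsRademacherLaw

/-! ### Variance bound for the Stein kernel. -/

lemma sq_sum_mul_le {ι : Type*} (s : Finset ι) (w a : ι → ℝ≥0∞) :
    (∑ i ∈ s, w i * a i) ^ 2 ≤ (∑ i ∈ s, w i) * ∑ i ∈ s, w i * a i ^ 2 := by
  have h := ENNReal.inner_le_weight_mul_Lp_of_nonneg s (p := 2) (by norm_num) w a
  have e : (1 : ℝ) - 2⁻¹ = 1 / 2 := by norm_num
  have e' : (2 : ℝ)⁻¹ = 1 / 2 := by norm_num
  rw [e, e'] at h
  calc _ ≤ (esqrt (∑ i ∈ s, w i) * esqrt (∑ i ∈ s, w i * a i ^ (2 : ℝ))) ^ 2 := by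
        gcongr; exact h
    _ = _ := by rw [mul_pow, esqrt_sq, esqrt_sq]; norm_num

lemma enorm_add_add_sq_le (a b c : ℝ) :
    ‖a + b + c‖ₑ ^ 2 ≤ 3 * (‖a‖ₑ ^ 2 + ‖b‖ₑ ^ 2 + ‖c‖ₑ ^ 2) := by
  have h (a : ℝ) : ‖a‖ₑ ^ 2 = ENNReal.ofReal (a ^ 2) := by
    rw [Real.enorm_eq_ofReal_abs, ← ENNReal.ofReal_pow (abs_nonneg _), sq_abs]
  rw [h, h, h, h, ← ENNReal.ofReal_add (by positivity) (by positivity),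
    ← ENNReal.ofReal_add (by positivity) (by positivity),
    show (3 : ℝ≥0∞) = ENNReal.ofReal 3 by norm_num, ← ENNReal.ofReal_mul (by norm_num)]
  refine ENNReal.ofReal_le_ofReal ?_
  nlinarith [sq_nonneg (a - b), sq_nonneg (a - c), sq_nonneg (b - c)]

namespace IsRademacherLaw

variable {p : ℕ → ℝ} {μ : Measure (ℕ → ℝ)} [IsProbabilityMeasure μ] (hμ : IsRademacherLaw p μ)

include hμ

/-- Joint Jensen inequality for a mixture of conditional means. -/
lemma lintegral_sum_mul_mix_sq_le (I : Finset ℕ) (S : Finset (Finset ℕ)) (w : Finset ℕ → ℝ)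
    (hw : ∀ s, 0 ≤ w s) {a b : ℕ → (ℕ → ℝ) → ℝ} (ha : ∀ k, Measurable (a k))
    (hb : ∀ k, Measurable (b k)) :
    ∫⁻ x, ‖∑ k ∈ I, a k x * ∑ s ∈ S, w s * condMean μ s (b k) x‖ₑ ^ 2 ∂μ ≤
      ENNReal.ofReal (∑ s ∈ S, w s) ^ 2 * ∑ j ∈ I, ∑ k ∈ I,
        esqrt (∫⁻ x, ‖a j x‖ₑ ^ 2 * ‖a k x‖ₑ ^ 2 ∂μ) *
        esqrt (∫⁻ x, ‖b j x‖ₑ ^ 2 * ‖b k x‖ₑ ^ 2 ∂μ) := by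
  set W : ℝ≥0∞ := ENNReal.ofReal (∑ s ∈ S, w s) with hW
  have hW' : W = ∑ s ∈ S, ENNReal.ofReal (w s) := ENNReal.ofReal_sum_of_nonneg fun s _ => hw s
  set g : Finset ℕ → (ℕ → ℝ) × (ℕ → ℝ) → ℝ≥0∞ := fun s z =>
    ∑ k ∈ I, ‖a k z.1‖ₑ * ‖b k (s.piecewise z.1 z.2)‖ₑ with hg
  have hbm (s : Finset ℕ) (k : ℕ) :
      Measurable fun z : (ℕ → ℝ) × (ℕ → ℝ) => ‖b k (s.piecewise z.1 z.2)‖ₑ :=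
    ((hb k).comp (measurable_piecewise_prod s)).enorm
  have ham (k : ℕ) : Measurable fun z : (ℕ → ℝ) × (ℕ → ℝ) => ‖a k z.1‖ₑ :=
    ((ha k).comp measurable_fst).enorm
  have hgm (s : Finset ℕ) : Measurable (g s) :=
    Finset.measurable_fun_sum _ fun k _ => (ham k).mul (hbm s k)
  -- For fixed `x`: move absolute values inside, then apply Cauchy–Schwarz over the weights and
  -- Jensen over the resampled variable. Keeping the sum over `k` inside the square is what produces
  -- the mixed products of `B₁` and `B₂`.
  have hpt (x : ℕ → ℝ) : ‖∑ k ∈ I, a k x * ∑ s ∈ S, w s * condMean μ s (b k) x‖ₑ ^ 2 ≤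
      W * ∑ s ∈ S, ENNReal.ofReal (w s) * ∫⁻ y, g s (x, y) ^ 2 ∂μ := by
    have h1 : ‖∑ k ∈ I, a k x * ∑ s ∈ S, w s * condMean μ s (b k) x‖ₑ ≤
        ∑ s ∈ S, ENNReal.ofReal (w s) * ∫⁻ y, g s (x, y) ∂μ := by
      calc _ ≤ ∑ k ∈ I, ‖a k x‖ₑ * ∑ s ∈ S, ENNReal.ofReal (w s) *
            ∫⁻ y, ‖b k (s.piecewise x y)‖ₑ ∂μ := by
            refine (enorm_sum_le _ _).trans (Finset.sum_le_sum fun k _ => ?_)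
            rw [enorm_mul]
            gcongr
            refine (enorm_sum_le _ _).trans (Finset.sum_le_sum fun s _ => ?_)
            rw [enorm_mul, Real.enorm_of_nonneg (hw s)]
            gcongr
            exact enorm_integral_le_lintegral_enorm _
        _ = _ := by
            simp only [Finset.mul_sum]
            rw [Finset.sum_comm]
            refine Finset.sum_congr rfl fun s _ => ?_
            have hk (k : ℕ) : Measurable fun y => ‖b k (s.piecewise x y)‖ₑ :=
              (hbm s k).comp measurable_prodMk_left
            simp only [hg]
            rw [lintegral_finsetSum _ fun k _ => (hk k).const_mul _, Finset.mul_sum]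
            refine Finset.sum_congr rfl fun k _ => ?_
            rw [lintegral_const_mul _ (hk k)]
            ring
    calc _ ≤ (∑ s ∈ S, ENNReal.ofReal (w s) * ∫⁻ y, g s (x, y) ∂μ) ^ 2 := by gcongr
      _ ≤ W * ∑ s ∈ S, ENNReal.ofReal (w s) * (∫⁻ y, g s (x, y) ∂μ) ^ 2 := by
          rw [hW']; exact sq_sum_mul_le _ _ _
      _ ≤ _ := by
          gcongr with s hs
          exact lintegral_sq_le ((hgm s).comp measurable_prodMk_left).aemeasurable
  have hs (s : Finset ℕ) : ∫⁻ x, ∫⁻ y, g s (x, y) ^ 2 ∂μ ∂μ ≤ ∑ j ∈ I, ∑ k ∈ I,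
        esqrt (∫⁻ x, ‖a j x‖ₑ ^ 2 * ‖a k x‖ₑ ^ 2 ∂μ) *
        esqrt (∫⁻ x, ‖b j x‖ₑ ^ 2 * ‖b k x‖ₑ ^ 2 ∂μ) := by
    rw [← lintegral_prod (fun z => g s z ^ 2) ((hgm s).pow_const 2).aemeasurable]
    have e : ∀ z, g s z ^ 2 = ∑ j ∈ I, ∑ k ∈ I, (‖a j z.1‖ₑ * ‖a k z.1‖ₑ) *
        (‖b j (s.piecewise z.1 z.2)‖ₑ * ‖b k (s.piecewise z.1 z.2)‖ₑ) := fun z => by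
      rw [sq, hg, Finset.sum_mul_sum]
      refine Finset.sum_congr rfl fun j _ => Finset.sum_congr rfl fun k _ => by ring
    simp only [e]
    have hq (j k : ℕ) : Measurable fun z : (ℕ → ℝ) × (ℕ → ℝ) => (‖a j z.1‖ₑ * ‖a k z.1‖ₑ) *
        (‖b j (s.piecewise z.1 z.2)‖ₑ * ‖b k (s.piecewise z.1 z.2)‖ₑ) :=
      ((ham j).mul (ham k)).mul ((hbm s j).mul (hbm s k))
    rw [lintegral_finsetSum _ fun j _ => Finset.measurable_fun_sum _ fun k _ => hq j k]
    refine Finset.sum_le_sum fun j _ => ?_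
    rw [lintegral_finsetSum _ fun k _ => hq j k]
    refine Finset.sum_le_sum fun k _ => ?_
    -- Cauchy–Schwarz on the product space separates the factors; the resampled point again has law
    -- `μ`, so neither the set `s` nor the copy remains visible.
    refine (lintegral_mul_le_esqrt ((ham j).mul (ham k)).aemeasurable
      ((hbm s j).mul (hbm s k)).aemeasurable).trans (le_of_eq ?_)
    congr 2
    · refine Eq.trans ?_ ((measurePreserving_fst (μ := μ) (ν := μ)).lintegral_comp
        (((ha j).enorm.pow_const 2).mul ((ha k).enorm.pow_const 2)))
      simp only [Pi.mul_apply, mul_pow]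
    · refine Eq.trans ?_ ((hμ.resample s).lintegral_comp
        (((hb j).enorm.pow_const 2).mul ((hb k).enorm.pow_const 2)))
      simp only [Pi.mul_apply, mul_pow]
  have hm (s : Finset ℕ) : Measurable fun x => ∫⁻ y, g s (x, y) ^ 2 ∂μ :=
    ((hgm s).pow_const 2).lintegral_prod_right'
  refine (lintegral_mono hpt).trans ?_
  rw [lintegral_const_mul _ (Finset.measurable_fun_sum _ fun s _ => (hm s).const_mul _),
    lintegral_finsetSum _ fun s _ => (hm s).const_mul _, sq, mul_assoc]
  gcongr
  rw [hW', Finset.sum_mul]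
  refine Finset.sum_le_sum fun s _ => ?_
  rw [lintegral_const_mul _ (hm s)]
  gcongr
  exact hs s

/-- The case of a single product. -/
lemma lintegral_mul_mix_sq_le (S : Finset (Finset ℕ)) (w : Finset ℕ → ℝ)
    (hw : ∀ s, 0 ≤ w s) (hw1 : ∑ s ∈ S, w s ≤ 1) {a b : (ℕ → ℝ) → ℝ} (ha : Measurable a)
    (hb : Measurable b) :
    ∫⁻ x, ‖a x * ∑ s ∈ S, w s * condMean μ s b x‖ₑ ^ 2 ∂μ ≤
      esqrt (∫⁻ x, ‖a x‖ₑ ^ 4 ∂μ) * esqrt (∫⁻ x, ‖b x‖ₑ ^ 4 ∂μ) := by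
  have h := hμ.lintegral_sum_mul_mix_sq_le {0} S w hw (a := fun _ => a) (b := fun _ => b)
    (fun _ => ha) fun _ => hb
  simp only [Finset.sum_singleton, ← pow_add] at h
  refine h.trans ?_
  have : ENNReal.ofReal (∑ s ∈ S, w s) ^ 2 ≤ 1 :=
    pow_le_one₀ (by simp) (ENNReal.ofReal_le_one.2 hw1)
  calc _ ≤ 1 * _ := mul_le_mul_left this _
    _ = _ := by rw [one_mul]

/-- The gradient along `l` annihilates conditional means given sets without `l` and commutes with
the others, so only sets of total weight at most `1 / 2` remain. -/
lemma grad_mixMean (n l : ℕ) {f : (ℕ → ℝ) → ℝ} (hf : Integrable f μ) :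
    grad p l (mixMean μ n f) =ᵐ[μ] fun x => ∑ A ∈ (Finset.range n).powerset with l ∈ A,
      subsetWeight n A * condMean μ A (grad p l f) x := by
  have h : ∀ᵐ x ∂μ, ∀ A : Finset ℕ, l ∈ A →
      grad p l (condMean μ A f) x = condMean μ A (grad p l f) x := by
    rw [ae_all_iff]
    intro A
    by_cases hl : l ∈ A
    · filter_upwards [hμ.grad_condMean_of_mem hl hf] with x hx _
      exact hx
    · exact .of_forall fun _ h => absurd h hl
  filter_upwards [h] with x hx
  have e : grad p l (mixMean μ n f) x = ∑ A ∈ (Finset.range n).powerset,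
      subsetWeight n A * grad p l (condMean μ A f) x := by
    simp only [grad, mixMean]
    rw [← Finset.sum_sub_distrib, Finset.mul_sum]
    exact Finset.sum_congr rfl fun A _ => by ring
  rw [e, Finset.sum_filter]
  refine Finset.sum_congr rfl fun A _ => ?_
  by_cases hl : l ∈ A
  · rw [if_pos hl, hx A hl]
  · rw [if_neg hl, (free_condMean_of_notMem hl f).grad_eq_zero, Pi.zero_apply, mul_zero]

omit [IsProbabilityMeasure μ] in
/-- The product rule for the discrete gradient. -/
lemma grad_mul (l : ℕ) (f g : (ℕ → ℝ) → ℝ) {x : ℕ → ℝ} (hx : x l = 1 ∨ x l = -1) :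
    grad p l (fun x => f x * g x) x = grad p l f x * g x + f x * grad p l g x +
      (-x l / √(p l * (1 - p l))) * (grad p l f x * grad p l g x) := by
  have h := hμ.sqrt_pos l
  rcases hx with hx | hx
  · have e : Function.update x l 1 = x := by rw [← hx, Function.update_eq_self]
    simp only [grad, hx, e]
    field_simp
    ring
  · have e : Function.update x l (-1) = x := by rw [← hx, Function.update_eq_self]
    simp only [grad, hx, e]
    field_simp
    ring

omit [IsProbabilityMeasure μ] in
lemma enorm_coeff_sq (l : ℕ) {x : ℕ → ℝ} (hx : x l = 1 ∨ x l = -1) :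
    ‖-x l / √(p l * (1 - p l))‖ₑ ^ 2 = weight p l := by
  have h : (-x l / √(p l * (1 - p l))) ^ 2 = 1 / (p l * (1 - p l)) := by
    rw [div_pow, Real.sq_sqrt (hμ.mul_pos l).le]
    rcases hx with hx | hx <;> rw [hx] <;> norm_num
  rw [Real.enorm_eq_ofReal_abs, ← ENNReal.ofReal_pow (abs_nonneg _), sq_abs, h, weight]

end IsRademacherLaw

/-- A Stein kernel, built from the gradients along the first `n` coordinates. -/
def steinKernel (p : ℕ → ℝ) (μ : Measure (ℕ → ℝ)) (n : ℕ) (f : (ℕ → ℝ) → ℝ) : (ℕ → ℝ) → ℝ :=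
  fun x => ∑ k ∈ Finset.range n, grad p k f x * mixMean μ n (grad p k f) x

lemma lintegral_const_mul_add_add_const_mul {α : Type*} [MeasurableSpace α] {μ : Measure α}
    (r w : ℝ≥0∞) {a b c : α → ℝ≥0∞} (ha : Measurable a) (hb : Measurable b) (hc : Measurable c) :
    ∫⁻ x, r * (a x + b x + w * c x) ∂μ =
      r * (∫⁻ x, a x ∂μ + ∫⁻ x, b x ∂μ + w * ∫⁻ x, c x ∂μ) := by
  have h1 : Measurable fun x => a x + b x := ha.add hb
  have h2 : Measurable fun x => a x + b x + w * c x := h1.add (hc.const_mul _)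
  rw [lintegral_const_mul _ h2, lintegral_add_left h1, lintegral_add_left ha,
    lintegral_const_mul _ hc]

lemma measurable_mixMean {μ : Measure (ℕ → ℝ)} [IsProbabilityMeasure μ] (n : ℕ)
    {f : (ℕ → ℝ) → ℝ} (hf : Measurable f) : Measurable (mixMean μ n f) :=
  Finset.measurable_fun_sum _ fun A _ => (measurable_condMean A hf).const_mul _

namespace IsRademacherLaw

variable {p : ℕ → ℝ} {μ : Measure (ℕ → ℝ)} [IsProbabilityMeasure μ] (hμ : IsRademacherLaw p μ)

include hμ

lemma memLp_grad_mul_mixMean (n k : ℕ) {f : (ℕ → ℝ) → ℝ} (hf : Measurable f)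
    (hD : MemLp (grad p k f) 4 μ) :
    MemLp (fun x => grad p k f x * mixMean μ n (grad p k f) x) 2 μ := by
  have hm := measurable_grad (p := p) (k := k) hf
  refine (memLp_two_iff (hm.mul (measurable_mixMean n hm)).aestronglyMeasurable).2 ?_
  refine (hμ.lintegral_mul_mix_sq_le _ _ (subsetWeight_nonneg n) (sum_subsetWeight n).le
    hm hm).trans_lt ?_
  rw [esqrt_mul_self]
  exact (memLp_four_iff hm.aestronglyMeasurable).1 hD

lemma memLp_steinKernel (n : ℕ) {f : (ℕ → ℝ) → ℝ} (hf : Measurable f)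
    (hD : ∀ k, MemLp (grad p k f) 4 μ) : MemLp (steinKernel p μ n f) 2 μ :=
  memLp_finsetSum _ fun k _ => hμ.memLp_grad_mul_mixMean n k hf (hD k)

lemma integral_steinKernel (n : ℕ) {f : (ℕ → ℝ) → ℝ} (hfm : Measurable f) (hf : MemLp f 2 μ) :
    ∫ x, steinKernel p μ n f x ∂μ = ∫ x, f x * condMean μ (Finset.range n) f x ∂μ -
      (∫ x, f x ∂μ) * ∫ x, f x ∂μ := by
  rw [hμ.covariance_formula n hfm hf hf]
  exact integral_finsetSum _ fun k _ => integrable_fun_mul (hμ.memLp_grad hf k)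
    (hμ.memLp_mixMean n (measurable_grad hfm) (hμ.memLp_grad hf k))

lemma grad_steinKernel (n l : ℕ) {f : (ℕ → ℝ) → ℝ} (hf : Integrable f μ) :
    ∀ᵐ x ∂μ, ‖grad p l (steinKernel p μ n f) x‖ₑ ^ 2 ≤
      3 * (‖∑ k ∈ Finset.range n, grad p l (grad p k f) x *
          ∑ A ∈ (Finset.range n).powerset, subsetWeight n A * condMean μ A (grad p k f) x‖ₑ ^ 2 +
        ‖∑ k ∈ Finset.range n, grad p k f x * ∑ A ∈ (Finset.range n).powerset with l ∈ A,
          subsetWeight n A * condMean μ A (grad p l (grad p k f)) x‖ₑ ^ 2 +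
        weight p l * ‖∑ k ∈ Finset.range n, grad p l (grad p k f) x *
          ∑ A ∈ (Finset.range n).powerset with l ∈ A,
          subsetWeight n A * condMean μ A (grad p l (grad p k f)) x‖ₑ ^ 2) := by
  have h : ∀ᵐ x ∂μ, ∀ k, grad p l (mixMean μ n (grad p k f)) x =
      ∑ A ∈ (Finset.range n).powerset with l ∈ A,
        subsetWeight n A * condMean μ A (grad p l (grad p k f)) x :=
    ae_all_iff.2 fun k => hμ.grad_mixMean n l (hμ.integrable_grad hf k)
  filter_upwards [h, hμ.ae_sign l] with x hx hs
  have e : grad p l (steinKernel p μ n f) x = ∑ k ∈ Finset.range n,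
      grad p l (fun x => grad p k f x * mixMean μ n (grad p k f) x) x := by
    simp only [grad, steinKernel]
    rw [← Finset.sum_sub_distrib, Finset.mul_sum]
  rw [e, Finset.sum_congr rfl fun k _ => hμ.grad_mul l _ _ hs]
  simp only [hx]
  rw [Finset.sum_add_distrib, Finset.sum_add_distrib, ← Finset.mul_sum]
  refine (enorm_add_add_sq_le _ _ _).trans (le_of_eq ?_)
  rw [enorm_mul (-x l / _), mul_pow, hμ.enorm_coeff_sq l hs]
  rfl

/-- The product rule yields three sums, hence a factor 3. The sum with the undifferentiated average
has weight mass 1; the other two involve only sets containing `l`, of squared mass at most `1 / 4`.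
So the first two give `3 (1 + 1/4) = 15/4`, and the discrete correction term gives `3/4`. -/
lemma lintegral_grad_steinKernel_le (n l : ℕ) {f : (ℕ → ℝ) → ℝ} (hfm : Measurable f)
    (hf : Integrable f μ) :
    ∫⁻ x, ‖grad p l (steinKernel p μ n f) x‖ₑ ^ 2 ∂μ ≤
      ENNReal.ofReal (15 / 4) * (∑ j ∈ Finset.range n, ∑ k ∈ Finset.range n,
        esqrt (∫⁻ x, ‖grad p j f x‖ₑ ^ 2 * ‖grad p k f x‖ₑ ^ 2 ∂μ) *
        esqrt (∫⁻ x, ‖grad p l (grad p j f) x‖ₑ ^ 2 * ‖grad p l (grad p k f) x‖ₑ ^ 2 ∂μ)) +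
      ENNReal.ofReal (3 / 4) * (∑ j ∈ Finset.range n, ∑ k ∈ Finset.range n, weight p l *
        ∫⁻ x, ‖grad p l (grad p j f) x‖ₑ ^ 2 * ‖grad p l (grad p k f) x‖ₑ ^ 2 ∂μ) := by
  have hm (k : ℕ) : Measurable (grad p k f) := measurable_grad hfm
  have hm2 (k : ℕ) : Measurable (grad p l (grad p k f)) := measurable_grad (hm k)
  have b1 := hμ.lintegral_sum_mul_mix_sq_le (Finset.range n) (Finset.range n).powerset
    (subsetWeight n) (subsetWeight_nonneg n) hm2 hm
  have b2 := hμ.lintegral_sum_mul_mix_sq_le (Finset.range n)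
    ((Finset.range n).powerset.filter (l ∈ ·))
    (subsetWeight n) (subsetWeight_nonneg n) hm hm2
  have b3 := hμ.lintegral_sum_mul_mix_sq_le (Finset.range n)
    ((Finset.range n).powerset.filter (l ∈ ·))
    (subsetWeight n) (subsetWeight_nonneg n) hm2 hm2
  have hW : ENNReal.ofReal (∑ A ∈ (Finset.range n).powerset with l ∈ A, subsetWeight n A) ^ 2 ≤
      ENNReal.ofReal (1 / 4) := by
    rw [← ENNReal.ofReal_pow (Finset.sum_nonneg fun A _ => subsetWeight_nonneg n A)]
    refine ENNReal.ofReal_le_ofReal ?_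
    have h0 : 0 ≤ ∑ A ∈ (Finset.range n).powerset with l ∈ A, subsetWeight n A :=
      Finset.sum_nonneg fun A _ => subsetWeight_nonneg n A
    nlinarith [sum_subsetWeight_mem_le n l]
  have hmix (S : Finset (Finset ℕ)) (g : ℕ → (ℕ → ℝ) → ℝ) (hg : ∀ k, Measurable (g k)) (k : ℕ) :
      Measurable fun x => ∑ A ∈ S, subsetWeight n A * condMean μ A (g k) x :=
    Finset.measurable_fun_sum _ fun A _ => (measurable_condMean A (hg k)).const_mul _
  have hmm (S : Finset (Finset ℕ)) (a g : ℕ → (ℕ → ℝ) → ℝ) (ha : ∀ k, Measurable (a k))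
      (hg : ∀ k, Measurable (g k)) : Measurable fun x => ‖∑ k ∈ Finset.range n, a k x *
        ∑ A ∈ S, subsetWeight n A * condMean μ A (g k) x‖ₑ ^ 2 :=
    (Finset.measurable_fun_sum _ fun k _ => (ha k).mul (hmix S g hg k)).enorm.pow_const 2
  refine (lintegral_mono_ae (hμ.grad_steinKernel n l hf)).trans ?_
  have m1 := hmm (Finset.range n).powerset _ _ hm2 hm
  have m2 := hmm ((Finset.range n).powerset.filter (l ∈ ·)) _ _ hm hm2
  have m3 := hmm ((Finset.range n).powerset.filter (l ∈ ·)) _ _ hm2 hm2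
  rw [lintegral_const_mul_add_add_const_mul 3 (weight p l) m1 m2 m3]
  set X := ∑ j ∈ Finset.range n, ∑ k ∈ Finset.range n,
        esqrt (∫⁻ x, ‖grad p j f x‖ₑ ^ 2 * ‖grad p k f x‖ₑ ^ 2 ∂μ) *
        esqrt (∫⁻ x, ‖grad p l (grad p j f) x‖ₑ ^ 2 * ‖grad p l (grad p k f) x‖ₑ ^ 2 ∂μ) with hX
  set Z := ∑ j ∈ Finset.range n, ∑ k ∈ Finset.range n,
        ∫⁻ x, ‖grad p l (grad p j f) x‖ₑ ^ 2 * ‖grad p l (grad p k f) x‖ₑ ^ 2 ∂μ with hZ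
  rw [sum_subsetWeight, ENNReal.ofReal_one, one_pow, one_mul] at b1
  simp only [mul_comm (esqrt (∫⁻ x, ‖grad p l (grad p _ f) x‖ₑ ^ 2 *
    ‖grad p l (grad p _ f) x‖ₑ ^ 2 ∂μ)) (esqrt (∫⁻ x, ‖grad p _ f x‖ₑ ^ 2 *
    ‖grad p _ f x‖ₑ ^ 2 ∂μ))] at b1
  simp only [esqrt_mul_self] at b3
  calc _ ≤ 3 * (X + ENNReal.ofReal (1 / 4) * X + weight p l * (ENNReal.ofReal (1 / 4) * Z)) := by
        gcongr
        · exact b2.trans (by gcongr)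
        · exact b3.trans (by gcongr)
    _ = (3 + 3 * ENNReal.ofReal (1 / 4)) * X + 3 * ENNReal.ofReal (1 / 4) * (weight p l * Z) := by
        ring
    _ = _ := by
        have e2 : 3 * ENNReal.ofReal (1 / 4) = ENNReal.ofReal (3 / 4) := by
          rw [show (3 : ℝ≥0∞) = ENNReal.ofReal 3 by norm_num, ← ENNReal.ofReal_mul (by norm_num)]
          norm_num
        have e1 : 3 + ENNReal.ofReal (3 / 4) = ENNReal.ofReal (15 / 4) := by
          rw [show (3 : ℝ≥0∞) = ENNReal.ofReal 3 by norm_num,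
            ← ENNReal.ofReal_add (by norm_num) (by norm_num)]
          norm_num
        rw [e2, e1, hZ]
        simp only [Finset.mul_sum]

lemma tsum_lintegral_grad_steinKernel_le (n : ℕ) {f : (ℕ → ℝ) → ℝ} (hfm : Measurable f)
    (hf : Integrable f μ) :
    ∑' l, ∫⁻ x, ‖grad p l (steinKernel p μ n f) x‖ₑ ^ 2 ∂μ ≤
      ENNReal.ofReal (15 / 4) * B1 p μ f + ENNReal.ofReal (3 / 4) * B2 p μ f := by
  have key (c : ℕ → ℕ → ℕ → ℝ≥0∞) :
      ∑' l, ∑ j ∈ Finset.range n, ∑ k ∈ Finset.range n, c j k l ≤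
        ∑' (j : ℕ) (k : ℕ) (l : ℕ), c j k l := by
    calc _ ≤ ∑' (l : ℕ) (j : ℕ) (k : ℕ), c j k l := ENNReal.tsum_le_tsum fun l =>
          (Finset.sum_le_sum fun j _ => ENNReal.sum_le_tsum _).trans (ENNReal.sum_le_tsum _)
      _ = _ := by
          rw [ENNReal.tsum_comm]
          exact tsum_congr fun j => ENNReal.tsum_comm
  refine (ENNReal.tsum_le_tsum fun l =>
    hμ.lintegral_grad_steinKernel_le n l hfm hf).trans ?_
  rw [ENNReal.tsum_add, ENNReal.tsum_mul_left, ENNReal.tsum_mul_left]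
  gcongr
  · exact key _
  · exact key _

lemma lintegral_steinKernel_sub_le (n : ℕ) {f : (ℕ → ℝ) → ℝ} (hfm : Measurable f)
    (hf : MemLp f 2 μ) (hD : ∀ k, MemLp (grad p k f) 4 μ) :
    ∫⁻ x, ‖steinKernel p μ n f x - ∫ y, steinKernel p μ n f y ∂μ‖ₑ ∂μ ≤
      ENNReal.ofReal (√15 / 2) * esqrt (B1 p μ f) + ENNReal.ofReal (√3 / 2) * esqrt (B2 p μ f) := by
  have hm : Measurable (steinKernel p μ n f) := Finset.measurable_fun_sum _ fun k _ =>
    (measurable_grad hfm).mul (measurable_mixMean n (measurable_grad hfm))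
  refine (hμ.lintegral_enorm_sub_mean_le hm (hμ.memLp_steinKernel n hfm hD)).trans ?_
  refine (esqrt_le_esqrt
    (hμ.tsum_lintegral_grad_steinKernel_le n hfm (hf.integrable (by norm_num)))).trans ?_
  refine (esqrt_add_le _ _).trans (le_of_eq ?_)
  rw [esqrt_mul, esqrt_mul, esqrt_ofReal (by norm_num), esqrt_ofReal (by norm_num),
    Real.sqrt_div (by norm_num), Real.sqrt_div (by norm_num),
    show (4 : ℝ) = 2 ^ 2 by norm_num, Real.sqrt_sq (by norm_num)]

end IsRademacherLaw

/-! ### The normal distribution function and Stein's equation. -/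

lemma gaussianPDFReal_zero_one (x : ℝ) :
    gaussianPDFReal 0 1 x = (√(2 * Real.pi))⁻¹ * Real.exp (-(x ^ 2 / 2)) := by
  rw [gaussianPDFReal]; simp; left; ring_nf

lemma continuous_gaussianPDFReal : Continuous (gaussianPDFReal 0 1) := by
  simp only [funext gaussianPDFReal_zero_one]; fun_prop

lemma hasDerivAt_gaussianPDFReal (x : ℝ) :
    HasDerivAt (gaussianPDFReal 0 1) (-x * gaussianPDFReal 0 1 x) x := by
  simp only [funext gaussianPDFReal_zero_one]
  have h : HasDerivAt (fun x : ℝ => -(x ^ 2 / 2)) (-x) x := by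
    refine (((hasDerivAt_id x).pow 2).div_const 2).neg.congr_deriv ?_
    simp
  exact ((h.exp).const_mul ((√(2 * Real.pi))⁻¹)).congr_deriv (by ring)

lemma sqrt_two_pi_mul_exp_mul_gaussianPDFReal (x : ℝ) :
    √(2 * Real.pi) * Real.exp (x ^ 2 / 2) * gaussianPDFReal 0 1 x = 1 := by
  have h : √(2 * Real.pi) ≠ 0 := by positivity
  rw [gaussianPDFReal_zero_one, Real.exp_neg]
  field_simp

lemma Phi_eq_cdf : Phi = cdf (gaussianReal 0 1) := by
  funext z; rw [Phi, cdf_eq_real]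

lemma Phi_nonneg (z : ℝ) : 0 ≤ Phi z := measureReal_nonneg

lemma Phi_le_one (z : ℝ) : Phi z ≤ 1 := measureReal_le_one

lemma Phi_neg (z : ℝ) : Phi (-z) = 1 - Phi z := by
  have h : (gaussianReal 0 1).map (fun x => -x) = gaussianReal 0 1 := by
    rw [gaussianReal_map_neg, neg_zero]
  have : NullSingletonClass (gaussianReal 0 1) := nullSingletonClass_gaussianReal one_ne_zero
  rw [Phi, ← h, map_measureReal_apply measurable_neg measurableSet_Iic, Phi,
    ← probReal_compl_eq_one_sub measurableSet_Iic]
  have e : (fun x : ℝ => -x) ⁻¹' Set.Iic (-z) = Set.Ici z := by ext; simp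
  rw [e, Set.compl_Iic, measureReal_def, measureReal_def, measure_congr (Ioi_ae_eq_Ici (μ := gaussianReal 0 1))]

lemma hasDerivAt_Phi (x : ℝ) : HasDerivAt Phi (gaussianPDFReal 0 1 x) x := by
  have hP (w : ℝ) : Phi w = ∫ t in Set.Iic w, gaussianPDFReal 0 1 t := by
    rw [Phi, measureReal_def, gaussianReal_apply_eq_integral _ one_ne_zero, ENNReal.toReal_ofReal]
    exact setIntegral_nonneg measurableSet_Iic fun t _ => gaussianPDFReal_nonneg _ _ _
  have hi : Integrable (gaussianPDFReal 0 1) := integrable_gaussianPDFReal 0 1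
  have e : Phi = fun w => Phi 0 + ∫ t in (0 : ℝ)..w, gaussianPDFReal 0 1 t := by
    funext w
    rw [← intervalIntegral.integral_Iic_sub_Iic hi.integrableOn hi.integrableOn, hP w, hP 0]
    ring
  rw [e]
  exact (continuous_gaussianPDFReal.integral_hasStrictDerivAt 0 x).hasDerivAt.const_add _

lemma continuous_Phi : Continuous Phi :=
  continuous_iff_continuousAt.2 fun x => (hasDerivAt_Phi x).continuousAt

lemma tendsto_Phi_atBot : Filter.Tendsto Phi Filter.atBot (nhds 0) := by
  rw [Phi_eq_cdf]; exact tendsto_cdf_atBot _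

lemma tendsto_pow_mul_gaussianPDFReal_atBot (n : ℕ) :
    Filter.Tendsto (fun x => x ^ n * gaussianPDFReal 0 1 x) Filter.atBot (nhds 0) := by
  have h := ((Real.tendsto_pow_mul_exp_neg_atTop_nhds_zero n).comp
    Filter.tendsto_neg_atBot_atTop).const_mul ((√(2 * Real.pi))⁻¹ * Real.exp (1 / 2))
  rw [mul_zero] at h
  refine squeeze_zero_norm' ?_ h
  filter_upwards [Filter.eventually_le_atBot 0] with x hx
  have h1 : Real.exp (-(x ^ 2 / 2)) ≤ Real.exp (1 / 2) * Real.exp (-(-x)) := by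
    rw [← Real.exp_add, Real.exp_le_exp]
    nlinarith [sq_nonneg (x + 1)]
  rw [norm_mul, norm_pow, Real.norm_eq_abs, abs_of_nonpos hx, gaussianPDFReal_zero_one,
    Real.norm_of_nonneg (by positivity)]
  have h2 : 0 ≤ (-x) ^ n := pow_nonneg (by linarith) n
  calc (-x) ^ n * ((√(2 * Real.pi))⁻¹ * Real.exp (-(x ^ 2 / 2)))
      ≤ (-x) ^ n * ((√(2 * Real.pi))⁻¹ * (Real.exp (1 / 2) * Real.exp (-(-x)))) := by gcongr
    _ = _ := by simp only [Function.comp]; ring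

lemma nonneg_of_hasDerivAt_of_tendsto {K k : ℝ → ℝ} {w : ℝ} (hK : ∀ t, HasDerivAt K (k t) t)
    (hk : ∀ t ≤ w, 0 ≤ k t) (hlim : Filter.Tendsto K Filter.atBot (nhds 0)) : 0 ≤ K w := by
  have hmono : MonotoneOn K (Set.Iic w) := by
    refine monotoneOn_of_deriv_nonneg (convex_Iic w)
      (fun t _ => (hK t).continuousAt.continuousWithinAt)
      (fun t _ => (hK t).differentiableAt.differentiableWithinAt) fun t ht => ?_
    rw [(hK t).deriv]
    rw [interior_Iic] at ht
    exact hk t ht.le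
  refine le_of_tendsto hlim ?_
  filter_upwards [Filter.eventually_le_atBot w] with t ht
  exact hmono ht Set.self_mem_Iic ht

/-- The expression equals `∫_{-∞}^w (w - t) φ(t) dt`. -/
lemma mul_Phi_add_nonneg (w : ℝ) : 0 ≤ w * Phi w + gaussianPDFReal 0 1 w := by
  refine nonneg_of_hasDerivAt_of_tendsto (K := fun t => w * Phi t + gaussianPDFReal 0 1 t)
    (k := fun t => (w - t) * gaussianPDFReal 0 1 t) (fun t => ?_) (fun t ht => ?_) ?_
  · exact (((hasDerivAt_Phi t).const_mul w).add (hasDerivAt_gaussianPDFReal t)).congr_deriv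
      (by ring)
  · exact mul_nonneg (by linarith) (gaussianPDFReal_nonneg _ _ _)
  · have := (tendsto_Phi_atBot.const_mul w).add (tendsto_pow_mul_gaussianPDFReal_atBot 0)
    simpa using this

/-- The expression equals `∫_{-∞}^w (w - t)² φ(t) dt`. It gives the sign of the derivative of
`millsMul`. -/
lemma add_sq_mul_Phi_add_nonneg (w : ℝ) :
    0 ≤ (1 + w ^ 2) * Phi w + w * gaussianPDFReal 0 1 w := by
  have := nonneg_of_hasDerivAt_of_tendsto (w := w)
    (K := fun t => (1 + w ^ 2) * Phi t + (2 * w * gaussianPDFReal 0 1 t -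
      t * gaussianPDFReal 0 1 t))
    (k := fun t => (w - t) ^ 2 * gaussianPDFReal 0 1 t) (fun t => ?_) (fun t ht => ?_) ?_
  · linarith
  · refine (((hasDerivAt_Phi t).const_mul (1 + w ^ 2)).add
      (((hasDerivAt_gaussianPDFReal t).const_mul (2 * w)).sub
        ((hasDerivAt_id t).mul (hasDerivAt_gaussianPDFReal t)))).congr_deriv ?_
    simp only [id]
    ring
  · exact mul_nonneg (sq_nonneg _) (gaussianPDFReal_nonneg _ _ _)
  · have := (tendsto_Phi_atBot.const_mul (1 + w ^ 2)).add
      (((tendsto_pow_mul_gaussianPDFReal_atBot 0).const_mul (2 * w)).sub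
        (tendsto_pow_mul_gaussianPDFReal_atBot 1))
    simpa using this

/-- The function `x ↦ x Φ(x) / φ(x)`. -/
def millsMul (x : ℝ) : ℝ := √(2 * Real.pi) * (x * Real.exp (x ^ 2 / 2) * Phi x)

lemma hasDerivAt_exp_sq_half (x : ℝ) :
    HasDerivAt (fun x : ℝ => Real.exp (x ^ 2 / 2)) (x * Real.exp (x ^ 2 / 2)) x := by
  have h : HasDerivAt (fun x : ℝ => x ^ 2 / 2) x x := by
    refine (((hasDerivAt_id x).pow 2).div_const 2).congr_deriv ?_
    simp
  rw [mul_comm]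
  exact h.exp

lemma monotone_millsMul : Monotone millsMul := by
  have h (x : ℝ) : HasDerivAt millsMul (√(2 * Real.pi) * (Real.exp (x ^ 2 / 2) *
      ((1 + x ^ 2) * Phi x + x * gaussianPDFReal 0 1 x))) x := by
    refine ((((hasDerivAt_id x).mul (hasDerivAt_exp_sq_half x)).mul
      (hasDerivAt_Phi x)).const_mul (√(2 * Real.pi))).congr_deriv ?_
    simp only [id, Pi.mul_apply]
    ring
  refine monotone_of_deriv_nonneg (fun x => (h x).differentiableAt) fun x => ?_
  rw [(h x).deriv]
  have := add_sq_mul_Phi_add_nonneg x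
  positivity

lemma neg_one_le_millsMul (x : ℝ) : -1 ≤ millsMul x := by
  have h := mul_Phi_add_nonneg x
  have h2 := sqrt_two_pi_mul_exp_mul_gaussianPDFReal x
  have h3 : 0 ≤ √(2 * Real.pi) * Real.exp (x ^ 2 / 2) := by positivity
  have := mul_nonneg h3 h
  rw [millsMul]
  nlinarith

lemma mul_steinSol_of_le {z w : ℝ} (h : w ≤ z) :
    w * steinSol z w = millsMul w * (1 - Phi z) := by
  rw [steinSol, if_pos h, millsMul]; ring

lemma mul_steinSol_of_ge {z w : ℝ} (h : z ≤ w) :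
    w * steinSol z w = -millsMul (-w) * Phi z := by
  rcases h.eq_or_lt with rfl | h
  · rw [mul_steinSol_of_le le_rfl, millsMul, millsMul, Phi_neg, neg_sq]; ring
  · rw [steinSol, if_neg (not_le.2 h), millsMul, Phi_neg, neg_sq]; ring

/-- To the left of `z` the function is a nonnegative multiple of `millsMul w`, to the right of
`-millsMul (-w)`; both are increasing, and the formulas agree at `z`. -/
lemma monotone_mul_steinSol (z : ℝ) : Monotone fun w => w * steinSol z w := by
  have h1 : ∀ a b, a ≤ b → b ≤ z → a * steinSol z a ≤ b * steinSol z b := fun a b hab hb => by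
    rw [mul_steinSol_of_le (hab.trans hb), mul_steinSol_of_le hb]
    exact mul_le_mul_of_nonneg_right (monotone_millsMul hab) (by linarith [Phi_le_one z])
  have h2 : ∀ a b, a ≤ b → z ≤ a → a * steinSol z a ≤ b * steinSol z b := fun a b hab ha => by
    rw [mul_steinSol_of_ge ha, mul_steinSol_of_ge (ha.trans hab)]
    exact mul_le_mul_of_nonneg_right (neg_le_neg (monotone_millsMul (neg_le_neg hab)))
      (Phi_nonneg z)
  intro a b hab
  rcases le_total b z with hb | hb
  · exact h1 a b hab hb
  · rcases le_total z a with ha | ha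
    · exact h2 a b hab ha
    · exact (h1 a z ha le_rfl).trans (h2 z b hb le_rfl)

/-- By monotonicity `w` may be moved to the right of `z`, where the value is `-millsMul (-w) * Phi
z` and `millsMul ≥ -1` applies. -/
lemma mul_steinSol_le (z w : ℝ) : w * steinSol z w ≤ Phi z := by
  refine (monotone_mul_steinSol z (le_max_left w z)).trans ?_
  simp only
  rw [mul_steinSol_of_ge (le_max_right w z)]
  nlinarith [neg_one_le_millsMul (-max w z), Phi_nonneg z]

lemma le_mul_steinSol (z w : ℝ) : -(1 - Phi z) ≤ w * steinSol z w := by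
  refine le_trans ?_ (monotone_mul_steinSol z (min_le_left w z))
  simp only
  rw [mul_steinSol_of_le (min_le_right w z)]
  nlinarith [neg_one_le_millsMul (min w z), Phi_le_one z]

/-- The derivative of the Stein solution, as given by Stein's equation. -/
def steinDeriv (z w : ℝ) : ℝ := w * steinSol z w + (if w ≤ z then 1 else 0) - Phi z

lemma abs_steinDeriv_le_one (z w : ℝ) : |steinDeriv z w| ≤ 1 := by
  have h1 := mul_steinSol_le z w
  have h2 := le_mul_steinSol z w
  have h3 := Phi_nonneg z
  have h4 := Phi_le_one z
  rw [steinDeriv, abs_le]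
  split_ifs <;> constructor <;> linarith

lemma continuous_steinSol (z : ℝ) : Continuous (steinSol z) := by
  have := continuous_Phi
  unfold steinSol
  refine Continuous.if_le (by fun_prop) (by fun_prop) continuous_id continuous_const ?_
  rintro w rfl
  ring

/-- The solution has a kink at `z`, but right derivatives exist everywhere and suffice for the mean
value inequality. At `t = z` the right derivative requires the strict indicator, in contrast to
`steinDeriv`. -/
lemma hasDerivWithinAt_steinSol (z t : ℝ) : HasDerivWithinAt (steinSol z)
    (t * steinSol z t + (if t < z then 1 else 0) - Phi z) (Set.Ici t) t := by
  have hφ := sqrt_two_pi_mul_exp_mul_gaussianPDFReal t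
  rcases lt_or_ge t z with h | h
  · rw [if_pos h]
    have hd := (((hasDerivAt_exp_sq_half t).const_mul (√(2 * Real.pi))).mul
      (hasDerivAt_Phi t)).mul_const (1 - Phi z)
    have he : steinSol z =ᶠ[nhds t] fun w =>
        √(2 * Real.pi) * Real.exp (w ^ 2 / 2) * Phi w * (1 - Phi z) := by
      filter_upwards [Iio_mem_nhds h] with w hw
      rw [steinSol, if_pos (le_of_lt hw)]
    refine (HasDerivAt.congr_of_eventuallyEq ?_ he).hasDerivWithinAt
    refine hd.congr_deriv ?_
    rw [he.eq_of_nhds]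
    linear_combination (1 - Phi z) * hφ
  · rw [if_neg (not_lt.2 h)]
    have hd := (((hasDerivAt_exp_sq_half t).const_mul (√(2 * Real.pi))).mul_const (Phi z)).mul
      ((hasDerivAt_Phi t).const_sub 1)
    have he : ∀ w ∈ Set.Ici t, steinSol z w =
        √(2 * Real.pi) * Real.exp (w ^ 2 / 2) * Phi z * (1 - Phi w) := by
      intro w hw
      rw [steinSol]
      split_ifs with hwz
      · have : w = z := le_antisymm hwz (h.trans hw)
        subst this; ring
      · rfl
    refine HasDerivWithinAt.congr ?_ he (he t Set.self_mem_Ici)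
    refine (hd.congr_deriv ?_).hasDerivWithinAt
    rw [he t Set.self_mem_Ici]
    linear_combination -(Phi z) * hφ

lemma abs_steinSol_sub_le (z a b : ℝ) : |steinSol z b - steinSol z a| ≤ |b - a| := by
  have key : ∀ a b, a ≤ b → |steinSol z b - steinSol z a| ≤ |b - a| := fun a b hab => by
    have := norm_image_sub_le_of_norm_deriv_right_le_segment (C := 1)
      (continuous_steinSol z).continuousOn (fun t _ => hasDerivWithinAt_steinSol z t)
      (fun t _ => ?_) b (Set.right_mem_Icc.2 hab)
    · rwa [one_mul, Real.norm_eq_abs, ← abs_of_nonneg (sub_nonneg.2 hab)] at this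
    · have h1 := mul_steinSol_le z t
      have h2 := le_mul_steinSol z t
      have h3 := Phi_nonneg z
      have h4 := Phi_le_one z
      rw [Real.norm_eq_abs, abs_le]
      split_ifs <;> constructor <;> linarith
  rcases le_total a b with h | h
  · exact key a b h
  · rw [abs_sub_comm, abs_sub_comm b]; exact key b a h

/-- The function `h(w) = w f_z(w) + 1_{w > z}`. -/
def steinMono (z w : ℝ) : ℝ := w * steinSol z w + if w ≤ z then 0 else 1

lemma monotone_steinMono (z : ℝ) : Monotone (steinMono z) := by
  refine (monotone_mul_steinSol z).add fun a b hab => ?_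
  split_ifs with h1 h2 <;> linarith

lemma abs_steinMono_le (z w : ℝ) : |steinMono z w| ≤ 2 := by
  have h1 := mul_steinSol_le z w
  have h2 := le_mul_steinSol z w
  have h3 := Phi_nonneg z
  have h4 := Phi_le_one z
  rw [steinMono, abs_le]
  split_ifs <;> constructor <;> linarith

/-- The first order expansion of the Stein solution, with a remainder controlled by the
increments of a monotone function. -/
lemma abs_steinSol_sub_sub_le (z a b c : ℝ) (hc : c = a ∨ c = b) :
    |steinSol z b - steinSol z a - steinDeriv z c * (b - a)| ≤
      (b - a) * (steinMono z b - steinMono z a) := by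
  have key : ∀ a b, a ≤ b → (c = a ∨ c = b) →
      |steinSol z b - steinSol z a - steinDeriv z c * (b - a)| ≤
      (b - a) * (steinMono z b - steinMono z a) := fun a b hab hc => by
    have := norm_image_sub_le_of_norm_deriv_right_le_segment (a := a) (b := b)
      (f := fun t => steinSol z t - steinDeriv z c * t) (C := steinMono z b - steinMono z a)
      (((continuous_steinSol z).sub (by fun_prop)).continuousOn)
      (fun t _ => (hasDerivWithinAt_steinSol z t).sub
        ((hasDerivAt_id t).const_mul (steinDeriv z c)).hasDerivWithinAt)
      (fun t ht => ?_) b (Set.right_mem_Icc.2 hab)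
    · rw [Real.norm_eq_abs] at this
      convert this using 1
      · congr 1; ring
      · ring
    · have h1 := monotone_mul_steinSol z ht.1
      have h2 := monotone_mul_steinSol z ht.2.le
      simp only at h1 h2
      obtain ⟨ht1, ht2⟩ := ht
      -- Up to a constant, the derivative is `w f_z(w)` minus `1_{w > z}`, two increasing functions
      -- whose sum is `h`; its change between `t` and the endpoint `c` is at most the increment of
      -- `h` over the interval.
      rw [Real.norm_eq_abs, abs_le, steinDeriv, steinMono, steinMono]
      rcases hc with rfl | rfl
      all_goals
        split_ifs <;> constructor <;> linarith
  rcases le_total a b with h | h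
  · exact key a b h hc
  · have := key b a h hc.symm
    rw [← abs_neg]
    convert this using 1
    · congr 1; ring
    · ring

lemma memLp_steinSol_comp {α : Type*} [MeasurableSpace α] {μ : Measure α} [IsFiniteMeasure μ]
    (z : ℝ) {f : α → ℝ} (hfm : Measurable f) (hf : MemLp f 2 μ) :
    MemLp (fun x => steinSol z (f x)) 2 μ := by
  refine MemLp.of_le ((memLp_const |steinSol z 0|).add hf.norm)
    ((continuous_steinSol z).measurable.comp hfm).aestronglyMeasurable (.of_forall fun x => ?_)
  have h := abs_steinSol_sub_le z 0 (f x)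
  have h2 := abs_sub_abs_le_abs_sub (steinSol z (f x)) (steinSol z 0)
  rw [sub_zero] at h
  simp only [Pi.add_apply, Real.norm_eq_abs]
  rw [abs_of_nonneg (by positivity : 0 ≤ |steinSol z 0| + |f x|)]
  linarith

lemma measurable_steinMono (z : ℝ) : Measurable (steinMono z) := (monotone_steinMono z).measurable

lemma measurable_steinDeriv (z : ℝ) : Measurable (steinDeriv z) := by
  have := (continuous_steinSol z).measurable
  unfold steinDeriv
  exact ((measurable_id.mul this).add
    (Measurable.ite measurableSet_Iic measurable_const measurable_const)).sub_const _

/-! ### Stein's method for functionals of the signs. -/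

/-- The summand of the remainder in Stein's method along the coordinate `k`. -/
def remainder (p : ℕ → ℝ) (μ : Measure (ℕ → ℝ)) (z : ℝ) (n : ℕ) (f : (ℕ → ℝ) → ℝ) (k : ℕ) :
    (ℕ → ℝ) → ℝ := fun x => grad p k (fun y => steinMono z (f y)) x *
      ((√(p k * (1 - p k)))⁻¹ * (grad p k f x * |mixMean μ n (grad p k f) x|))

namespace IsRademacherLaw

variable {p : ℕ → ℝ} {μ : Measure (ℕ → ℝ)} [IsProbabilityMeasure μ] (hμ : IsRademacherLaw p μ)

include hμ

omit [IsProbabilityMeasure μ] in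
lemma grad_mul_grad_steinMono_nonneg (z : ℝ) (f : (ℕ → ℝ) → ℝ) (k : ℕ) (x : ℕ → ℝ) :
    0 ≤ grad p k (fun y => steinMono z (f y)) x * grad p k f x := by
  have h := monotone_steinMono z
  have hs := hμ.sqrt_pos k
  have : 0 ≤ (steinMono z (f (Function.update x k 1)) - steinMono z (f (Function.update x k (-1)))) *
      (f (Function.update x k 1) - f (Function.update x k (-1))) := by
    rcases le_total (f (Function.update x k 1)) (f (Function.update x k (-1))) with hl | hl
    · exact mul_nonneg_of_nonpos_of_nonpos (sub_nonpos.2 (h hl)) (sub_nonpos.2 hl)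
    · exact mul_nonneg (sub_nonneg.2 (h hl)) (sub_nonneg.2 hl)
  rw [grad, grad, mul_mul_mul_comm]
  positivity

omit [IsProbabilityMeasure μ] in
lemma remainder_nonneg (z : ℝ) (n : ℕ) (f : (ℕ → ℝ) → ℝ) (k : ℕ) (x : ℕ → ℝ) :
    0 ≤ remainder p μ z n f k x := by
  have h := hμ.grad_mul_grad_steinMono_nonneg z f k x
  have hs := hμ.sqrt_pos k
  have e : remainder p μ z n f k x = (√(p k * (1 - p k)))⁻¹ *
    ((grad p k (fun y => steinMono z (f y)) x * grad p k f x) *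
      |mixMean μ n (grad p k f) x|) := by rw [remainder]; ring
  rw [e]
  positivity

omit [IsProbabilityMeasure μ] in
-- On the signs, `f x` is one of the two values between which `D_k` takes the difference, so the
-- expansion `abs_steinSol_sub_sub_le` applies at an endpoint. Its product of two increments
-- contains two gradients, which leaves one factor `(p_k q_k)^{-1/2}`.
lemma abs_grad_steinSol_sub_mul_le (z : ℝ) (n : ℕ) (f : (ℕ → ℝ) → ℝ) (k : ℕ) {x : ℕ → ℝ}
    (hx : x k = 1 ∨ x k = -1) :
    |(grad p k (fun y => steinSol z (f y)) x - steinDeriv z (f x) * grad p k f x) *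
      mixMean μ n (grad p k f) x| ≤ remainder p μ z n f k x := by
  have hs := hμ.sqrt_pos k
  set s := √(p k * (1 - p k)) with hsd
  have hc : f x = f (Function.update x k (-1)) ∨ f x = f (Function.update x k 1) := by
    rcases hx with hx | hx
    · right; rw [← hx, Function.update_eq_self]
    · left; rw [← hx, Function.update_eq_self]
  have h := abs_steinSol_sub_sub_le z (f (Function.update x k (-1))) (f (Function.update x k 1))
    (f x) hc
  rw [abs_mul, remainder]
  simp only [grad, ← hsd]
  calc _ = s * |steinSol z (f (Function.update x k 1)) - steinSol z (f (Function.update x k (-1))) -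
        steinDeriv z (f x) * (f (Function.update x k 1) - f (Function.update x k (-1)))| *
        |mixMean μ n (grad p k f) x| := by
        congr 1
        rw [← abs_of_pos hs, ← abs_mul, abs_of_pos hs]
        congr 1
        ring
    _ ≤ s * ((f (Function.update x k 1) - f (Function.update x k (-1))) *
        (steinMono z (f (Function.update x k 1)) - steinMono z (f (Function.update x k (-1))))) *
        |mixMean μ n (grad p k f) x| := by gcongr
    _ = _ := by
        field_simp

/-- Stein's method with a kernel built from finitely many coordinates. -/
lemma ofReal_abs_integral_steinDeriv_sub_le (z : ℝ) (n : ℕ) {f : (ℕ → ℝ) → ℝ}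
    (hfm : Measurable f) (hf : MemLp f 2 μ) (h0 : ∫ x, f x ∂μ = 0)
    (hD : ∀ k, MemLp (grad p k f) 4 μ) :
    ENNReal.ofReal |∫ x, steinDeriv z (f x) ∂μ -
        ∫ x, steinSol z (f x) * condMean μ (Finset.range n) f x ∂μ| ≤
      ENNReal.ofReal |1 - ∫ x, f x * condMean μ (Finset.range n) f x ∂μ| +
      (ENNReal.ofReal (√15 / 2) * esqrt (B1 p μ f) +
        ENNReal.ofReal (√3 / 2) * esqrt (B2 p μ f)) +
      ∑ k ∈ Finset.range n, ∫⁻ x, ENNReal.ofReal (remainder p μ z n f k x) ∂μ := by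
  set d : (ℕ → ℝ) → ℝ := fun x => steinDeriv z (f x) with hd
  have hdm : AEStronglyMeasurable d μ :=
    ((measurable_steinDeriv z).comp hfm).aestronglyMeasurable
  have hdb : ∀ᵐ x ∂μ, ‖d x‖ ≤ 1 := .of_forall fun x => abs_steinDeriv_le_one z (f x)
  have hdi : Integrable d μ := Integrable.of_bound hdm 1 hdb
  have hS := memLp_steinSol_comp z hfm hf
  set G : ℕ → (ℕ → ℝ) → ℝ := fun k => mixMean μ n (grad p k f) with hG
  have hG2 (k : ℕ) : MemLp (G k) 2 μ :=
    hμ.memLp_mixMean n (measurable_grad hfm) (hμ.memLp_grad hf k)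
  have hT : MemLp (steinKernel p μ n f) 2 μ := hμ.memLp_steinKernel n hfm hD
  have hTi := hT.integrable (by norm_num)
  have i1 (k : ℕ) : Integrable (fun x => grad p k (fun y => steinSol z (f y)) x * G k x) μ :=
    integrable_fun_mul (hμ.memLp_grad hS k) (hG2 k)
  have i2 (k : ℕ) : Integrable (fun x => d x * (grad p k f x * G k x)) μ :=
    (integrable_fun_mul (hμ.memLp_grad hf k) (hG2 k)).bdd_mul hdm hdb
  have e1 : ∫ x, d x * steinKernel p μ n f x ∂μ =
      ∑ k ∈ Finset.range n, ∫ x, d x * (grad p k f x * G k x) ∂μ := by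
    simp only [steinKernel, Finset.mul_sum]
    exact integral_finsetSum _ fun k _ => i2 k
  have hcov := hμ.covariance_formula n hfm hf hS
  rw [h0, mul_zero, sub_zero] at hcov
  have idT : Integrable (fun x => d x * steinKernel p μ n f x) μ := hTi.bdd_mul hdm hdb
  have e2 : ∫ x, d x ∂μ - ∫ x, steinSol z (f x) * condMean μ (Finset.range n) f x ∂μ =
      ∫ x, d x * (1 - steinKernel p μ n f x) ∂μ - ∑ k ∈ Finset.range n,
        ∫ x, (grad p k (fun y => steinSol z (f y)) x - d x * grad p k f x) * G k x ∂μ := by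
    have e3 (k : ℕ) :
        ∫ x, (grad p k (fun y => steinSol z (f y)) x - d x * grad p k f x) * G k x ∂μ =
        ∫ x, grad p k (fun y => steinSol z (f y)) x * G k x ∂μ -
          ∫ x, d x * (grad p k f x * G k x) ∂μ := by
      rw [← integral_sub (i1 k) (i2 k)]
      congr 1 with x
      ring
    simp only [e3, mul_sub, mul_one]
    rw [integral_sub hdi idT, Finset.sum_sub_distrib, e1, hcov]
    ring
  rw [e2]
  have hET := hμ.integral_steinKernel n hfm hf
  rw [h0, mul_zero, sub_zero] at hET
  rw [← hET]
  have t1 : ‖∫ x, d x * (1 - steinKernel p μ n f x) ∂μ‖ₑ ≤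
      ENNReal.ofReal |1 - ∫ x, steinKernel p μ n f x ∂μ| +
      (ENNReal.ofReal (√15 / 2) * esqrt (B1 p μ f) +
        ENNReal.ofReal (√3 / 2) * esqrt (B2 p μ f)) := by
    -- As `|d| ≤ 1`, it remains to split `1 - T` into `1 - E[T]` and the fluctuation of `T`.
    refine (enorm_integral_le_lintegral_enorm _).trans ?_
    calc _ ≤ ∫⁻ x, (‖1 - ∫ y, steinKernel p μ n f y ∂μ‖ₑ +
          ‖steinKernel p μ n f x - ∫ y, steinKernel p μ n f y ∂μ‖ₑ) ∂μ := by
          refine lintegral_mono fun x => ?_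
          rw [enorm_mul]
          have hd1 : ‖d x‖ₑ ≤ 1 := by
            rw [Real.enorm_eq_ofReal_abs, ENNReal.ofReal_le_one]
            exact abs_steinDeriv_le_one z (f x)
          calc _ ≤ 1 * ‖1 - steinKernel p μ n f x‖ₑ := by gcongr
            _ = ‖(1 - ∫ y, steinKernel p μ n f y ∂μ) -
                (steinKernel p μ n f x - ∫ y, steinKernel p μ n f y ∂μ)‖ₑ := by
                rw [one_mul]; congr 1; ring
            _ ≤ _ := enorm_sub_le
      _ ≤ _ := by
          rw [lintegral_add_left measurable_const, lintegral_const, measure_univ, mul_one,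
            Real.enorm_eq_ofReal_abs]
          gcongr
          exact hμ.lintegral_steinKernel_sub_le n hfm hf hD
  rw [← Real.enorm_eq_ofReal_abs]
  refine enorm_sub_le.trans (add_le_add t1 ?_)
  refine (enorm_sum_le _ _).trans (Finset.sum_le_sum fun k _ => ?_)
  refine (enorm_integral_le_lintegral_enorm _).trans (lintegral_mono_ae ?_)
  filter_upwards [hμ.ae_sign k] with x hx
  rw [Real.enorm_eq_ofReal_abs]
  exact ENNReal.ofReal_le_ofReal (hμ.abs_grad_steinSol_sub_mul_le z n f k hx)

/-- The passage `n → ∞`: the truncated `E[f_z(F) F]` converges to the true one, and the kernel mean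
`E[F E[F | X_0, …, X_{n-1}]]` converges to `E[F²] = 1`, so its defect disappears. -/
lemma ofReal_abs_measure_sub_Phi_le (z : ℝ) {f : (ℕ → ℝ) → ℝ}
    (hfm : Measurable f) (hf : MemLp f 2 μ) (h0 : ∫ x, f x ∂μ = 0) (h1 : ∫ x, f x ^ 2 ∂μ = 1)
    (hD : ∀ k, MemLp (grad p k f) 4 μ) {ρ : ℝ≥0∞} (hρ : ∀ n,
      ∑ k ∈ Finset.range n, ∫⁻ x, ENNReal.ofReal (remainder p μ z n f k x) ∂μ ≤ ρ) :
    ENNReal.ofReal |(μ.map f).real (Set.Iic z) - Phi z| ≤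
      ENNReal.ofReal (√15 / 2) * esqrt (B1 p μ f) +
        ENNReal.ofReal (√3 / 2) * esqrt (B2 p μ f) + ρ := by
  have hS := memLp_steinSol_comp z hfm hf
  have l1 := hμ.tendsto_integral_mul_condMean hfm hf hS
  have l2 := hμ.tendsto_integral_mul_condMean hfm hf hf
  simp only [← sq, h1] at l2
  have e : (μ.map f).real (Set.Iic z) - Phi z =
      ∫ x, steinDeriv z (f x) ∂μ - ∫ x, steinSol z (f x) * f x ∂μ := by
    have hdi : Integrable (fun x => steinDeriv z (f x)) μ := Integrable.of_bound
      ((measurable_steinDeriv z).comp hfm).aestronglyMeasurable 1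
      (.of_forall fun x => abs_steinDeriv_le_one z (f x))
    rw [← integral_sub hdi (integrable_fun_mul hS hf), map_measureReal_apply hfm measurableSet_Iic,
      ← integral_indicator_one (hfm measurableSet_Iic)]
    have hi : Integrable ((f ⁻¹' Set.Iic z).indicator (1 : (ℕ → ℝ) → ℝ)) μ :=
      (integrable_const 1).indicator (hfm measurableSet_Iic)
    have : ∀ x, steinDeriv z (f x) - steinSol z (f x) * f x =
        (f ⁻¹' Set.Iic z).indicator 1 x - Phi z := fun x => by
      simp only [steinDeriv, Set.indicator, Set.mem_preimage, Set.mem_Iic, Pi.one_apply]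
      ring
    simp only [this]
    rw [integral_sub hi (integrable_const _), integral_const]
    simp
  rw [e]
  have L := (ENNReal.continuous_ofReal.tendsto _).comp
    ((l1.const_sub (∫ x, steinDeriv z (f x) ∂μ)).abs)
  have R := (ENNReal.continuous_ofReal.tendsto _).comp ((l2.const_sub 1).abs)
  simp only [sub_self, abs_zero, ENNReal.ofReal_zero] at R
  have R' := (R.add_const (ENNReal.ofReal (√15 / 2) * esqrt (B1 p μ f) +
        ENNReal.ofReal (√3 / 2) * esqrt (B2 p μ f))).add_const ρ
  rw [zero_add] at R'
  refine le_of_tendsto_of_tendsto' L R' fun n => ?_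
  refine (hμ.ofReal_abs_integral_steinDeriv_sub_le z n hfm hf h0 hD).trans ?_
  simp only [Function.comp]
  gcongr
  exact hρ n

end IsRademacherLaw

/-! ### Estimates of the remainder, directly and through the divergence. -/

lemma abs_grad_abs_le (p : ℕ → ℝ) (l : ℕ) (f : (ℕ → ℝ) → ℝ) (x : ℕ → ℝ) :
    |grad p l (fun y => |f y|) x| ≤ |grad p l f x| := by
  rw [grad, grad, abs_mul, abs_mul]
  exact mul_le_mul_of_nonneg_left (abs_abs_sub_abs_le (f (Function.update x l 1))
    (f (Function.update x l (-1)))) (abs_nonneg _)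

lemma enorm_abs_real (a : ℝ) : ‖|a|‖ₑ = ‖a‖ₑ := by
  rw [Real.enorm_eq_ofReal_abs, Real.enorm_eq_ofReal_abs, abs_abs]

lemma sum_esqrt_mul_esqrt_le {ι : Type*} (s : Finset ι) (a b : ι → ℝ≥0∞) :
    ∑ i ∈ s, esqrt (a i) * esqrt (b i) ≤ esqrt (∑ i ∈ s, a i) * esqrt (∑ i ∈ s, b i) := by
  have h := ENNReal.inner_le_Lp_mul_Lq s (fun i => esqrt (a i)) (fun i => esqrt (b i))
    Real.HolderConjugate.two_two
  have e (c : ι → ℝ≥0∞) : ∑ i ∈ s, esqrt (c i) ^ (2 : ℝ) = ∑ i ∈ s, c i :=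
    Finset.sum_congr rfl fun i _ => by
      rw [show (2 : ℝ) = ((2 : ℕ) : ℝ) by norm_num, ENNReal.rpow_natCast, esqrt_sq]
  rw [e, e] at h
  exact h

/-- The integrand of the divergence term. -/
def stepSeq (p : ℕ → ℝ) (μ : Measure (ℕ → ℝ)) (n : ℕ) (f : (ℕ → ℝ) → ℝ) (k : ℕ) :
    (ℕ → ℝ) → ℝ := fun x =>
  (√(p k * (1 - p k)))⁻¹ * (grad p k f x * |mixMean μ n (grad p k f) x|)

lemma Free.mixMean {μ : Measure (ℕ → ℝ)} {n k : ℕ} {f : (ℕ → ℝ) → ℝ} (h : Free k f) :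
    Free k (mixMean μ n f) := fun x c => by
  simp only [Rademacher.mixMean, h.condMean x c]

lemma free_stepSeq (p : ℕ → ℝ) (μ : Measure (ℕ → ℝ)) (n : ℕ) (f : (ℕ → ℝ) → ℝ) (k : ℕ) :
    Free k (stepSeq p μ n f k) := fun x c => by
  simp only [stepSeq, free_grad p k f x c, (free_grad p k f).mixMean x c]

namespace IsRademacherLaw

variable {p : ℕ → ℝ} {μ : Measure (ℕ → ℝ)} (hμ : IsRademacherLaw p μ)

include hμ

lemma enorm_inv_sqrt_sq (k : ℕ) : ‖(√(p k * (1 - p k)))⁻¹‖ₑ ^ 2 = weight p k := by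
  rw [Real.enorm_eq_ofReal_abs, ← ENNReal.ofReal_pow (abs_nonneg _), sq_abs, inv_pow,
    Real.sq_sqrt (hμ.mul_pos k).le, weight, one_div]

lemma grad_normalized (k : ℕ) (x : ℕ → ℝ) : grad p k (normalized p k) x = 1 := by
  have h := hμ.sqrt_pos k
  simp only [grad, normalized, Function.update_self]
  field_simp
  ring

lemma integral_normalized_mul_sq {u : (ℕ → ℝ) → ℝ} {k : ℕ} (hu : Free k u) (h : MemLp u 2 μ) :
    ∫ x, (normalized p k x * u x) * (normalized p k x * u x) ∂μ = ∫ x, u x ^ 2 ∂μ := by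
  have hY := hμ.memLp_normalized_mul h k
  have h1 := hμ.integral_normalized_mul (integrable_fun_mul hY h) k
  have e : ∀ x, grad p k (fun x => normalized p k x * u x * u x) x = u x ^ 2 := fun x => by
    have := grad_mul_of_free (p := p) (f := normalized p k) (hu.mul hu) x
    simp only [← mul_assoc] at this
    rw [this, hμ.grad_normalized]
    ring
  simp only [e] at h1
  rw [← h1]
  congr 1 with x
  ring

/-- Two integrations by parts. Along `k` the gradient falls on `u` alone since `v` is free of `k`;
along `j` it then falls on `v` alone since `u` is free of `j`. -/
lemma integral_normalized_mul_normalized_mul {u v : (ℕ → ℝ) → ℝ} {j k : ℕ} (hjk : j ≠ k)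
    (hu : Free j u) (hv : Free k v) (h2u : MemLp u 2 μ) (h2v : MemLp v 2 μ) :
    ∫ x, (normalized p j x * u x) * (normalized p k x * v x) ∂μ =
      ∫ x, grad p k u x * grad p j v x ∂μ := by
  have h1 := hμ.integral_normalized_mul
    (integrable_fun_mul (hμ.memLp_normalized_mul h2u j) h2v) k
  have e1 : ∀ x, grad p k (fun x => normalized p j x * u x * v x) x =
      normalized p j x * (grad p k u x * v x) := fun x => by
    have := grad_mul_of_free (p := p) (f := u) ((free_normalized p hjk.symm).mul hv) x
    have e : (fun x => normalized p j x * u x * v x) =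
      fun x => u x * (normalized p j x * v x) := by funext x; ring
    rw [e, this]
    ring
  simp only [e1] at h1
  have h2 := hμ.integral_normalized_mul (integrable_fun_mul (hμ.memLp_grad h2u k) h2v) j
  have e2 : ∀ x, grad p j (fun x => grad p k u x * v x) x = grad p k u x * grad p j v x :=
    fun x => by
    have e : (fun x => grad p k u x * v x) = fun x => v x * grad p k u x := by funext x; ring
    rw [e, grad_mul_of_free hu.grad]
    ring
  simp only [e2] at h2
  rw [← h2, ← h1]
  congr 1 with x
  ring

/-- The Skorohod isometry, as an upper bound. -/
lemma integral_sum_normalized_mul_sq_le (I : Finset ℕ) {u : ℕ → (ℕ → ℝ) → ℝ}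
    (hu : ∀ k, Free k (u k)) (h : ∀ k, MemLp (u k) 2 μ) :
    ∫ x, (∑ k ∈ I, normalized p k x * u k x) ^ 2 ∂μ ≤
      ∑ k ∈ I, ∫ x, u k x ^ 2 ∂μ + ∑ k ∈ I, ∑ l ∈ I, ∫ x, grad p l (u k) x ^ 2 ∂μ := by
  have hY (k : ℕ) := hμ.memLp_normalized_mul (h k) k
  have hi (j k : ℕ) := integrable_fun_mul (hY j) (hY k)
  -- Off the diagonal, `ab ≤ a²/2 + b²/2` decouples the crossed gradients; the two halves coincide
  -- after summation over all pairs.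
  have key (j k : ℕ) : ∫ x, (normalized p j x * u j x) * (normalized p k x * u k x) ∂μ ≤
      (if j = k then ∫ x, u k x ^ 2 ∂μ else 0) +
      (1 / 2 * ∫ x, grad p k (u j) x ^ 2 ∂μ + 1 / 2 * ∫ x, grad p j (u k) x ^ 2 ∂μ) := by
    have hn1 : 0 ≤ ∫ x, grad p k (u j) x ^ 2 ∂μ := integral_nonneg fun x => sq_nonneg _
    have hn2 : 0 ≤ ∫ x, grad p j (u k) x ^ 2 ∂μ := integral_nonneg fun x => sq_nonneg _
    by_cases hjk : j = k
    · subst hjk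
      rw [if_pos rfl, hμ.integral_normalized_mul_sq (hu j) (h j)]
      linarith
    · have g1 := hμ.memLp_grad (h j) k
      have g2 := hμ.memLp_grad (h k) j
      rw [if_neg hjk, hμ.integral_normalized_mul_normalized_mul hjk (hu j) (hu k) (h j) (h k),
        zero_add, ← integral_const_mul, ← integral_const_mul, ← integral_add
        (g1.integrable_sq.const_mul _) (g2.integrable_sq.const_mul _)]
      refine integral_mono (integrable_fun_mul g1 g2)
        ((g1.integrable_sq.const_mul _).add (g2.integrable_sq.const_mul _)) fun x => ?_
      nlinarith [sq_nonneg (grad p k (u j) x - grad p j (u k) x)]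
  have e : ∫ x, (∑ k ∈ I, normalized p k x * u k x) ^ 2 ∂μ = ∑ j ∈ I, ∑ k ∈ I,
      ∫ x, (normalized p j x * u j x) * (normalized p k x * u k x) ∂μ := by
    simp only [sq, Finset.sum_mul_sum]
    rw [integral_finsetSum _ fun j _ => integrable_finsetSum _ fun k _ => hi j k]
    exact Finset.sum_congr rfl fun j _ => integral_finsetSum _ fun k _ => hi j k
  rw [e]
  refine (Finset.sum_le_sum fun j _ => Finset.sum_le_sum fun k _ => key j k).trans (le_of_eq ?_)
  simp only [Finset.sum_add_distrib]
  congr 1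
  · simp
  · rw [Finset.sum_comm (f := fun j k => 1 / 2 * ∫ x, grad p j (u k) x ^ 2 ∂μ)]
    simp only [← Finset.mul_sum]
    ring

variable [IsProbabilityMeasure μ]

/-- Since `|h| ≤ 2`, the gradient of `h(F)` is at most `4 √(p_k q_k)`, which cancels the singular
factor; two applications of Cauchy–Schwarz leave the fourth moment. -/
lemma lintegral_remainder_le_of_bounded (z : ℝ) (n k : ℕ) {f : (ℕ → ℝ) → ℝ}
    (hfm : Measurable f) :
    ∫⁻ x, ENNReal.ofReal (remainder p μ z n f k x) ∂μ ≤
      4 * esqrt (∫⁻ x, ‖grad p k f x‖ₑ ^ 4 ∂μ) := by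
  have hs := hμ.sqrt_pos k
  have hm := measurable_grad (p := p) (k := k) hfm
  have hmm : Measurable fun x => grad p k f x * mixMean μ n (grad p k f) x :=
    hm.mul (measurable_mixMean n hm)
  have hpt (x : ℕ → ℝ) : ENNReal.ofReal (remainder p μ z n f k x) ≤
      4 * ‖grad p k f x * mixMean μ n (grad p k f) x‖ₑ := by
    rw [Real.enorm_eq_ofReal_abs, show (4 : ℝ≥0∞) = ENNReal.ofReal 4 by norm_num,
      ← ENNReal.ofReal_mul (by norm_num)]
    refine ENNReal.ofReal_le_ofReal ((le_abs_self _).trans ?_)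
    have h1 : |grad p k (fun y => steinMono z (f y)) x| ≤ √(p k * (1 - p k)) * 4 := by
      rw [grad, abs_mul, abs_of_pos hs]
      gcongr
      have a := abs_steinMono_le z (f (Function.update x k 1))
      have b := abs_steinMono_le z (f (Function.update x k (-1)))
      exact (abs_sub _ _).trans (by linarith)
    rw [remainder, abs_mul, abs_mul, abs_mul, abs_mul, abs_abs, abs_of_pos (inv_pos.2 hs)]
    calc _ ≤ (√(p k * (1 - p k)) * 4) * ((√(p k * (1 - p k)))⁻¹ *
          (|grad p k f x| * |mixMean μ n (grad p k f) x|)) := by gcongr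
      _ = _ := by field_simp
  refine (lintegral_mono hpt).trans ?_
  rw [lintegral_const_mul _ hmm.enorm]
  gcongr
  refine le_esqrt ((lintegral_sq_le hmm.enorm.aemeasurable).trans ?_)
  refine (hμ.lintegral_mul_mix_sq_le _ _ (subsetWeight_nonneg n) (sum_subsetWeight n).le
    hm hm).trans (le_of_eq ?_)
  rw [esqrt_mul_self]

/-- The remainder when only the coordinates in `S` matter. -/
lemma sum_lintegral_remainder_le_of_finset (z : ℝ) (n : ℕ) {f : (ℕ → ℝ) → ℝ} (hfm : Measurable f)
    (S : Finset ℕ) (hS : ∀ k ∈ Finset.range n, k ∉ S → grad p k f =ᵐ[μ] 0) :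
    ∑ k ∈ Finset.range n, ∫⁻ x, ENNReal.ofReal (remainder p μ z n f k x) ∂μ ≤
      ENNReal.ofReal (4 * √(∑ k ∈ S, p k * (1 - p k))) * esqrt (B3 p μ f) := by
  set a : ℕ → ℝ≥0∞ := fun k => ∫⁻ x, ‖grad p k f x‖ₑ ^ 4 ∂μ with ha
  have h0 : ∀ k ∈ Finset.range n, k ∉ S → esqrt (a k) = 0 := by
    intro k hk hkS
    have : a k = 0 := by
      rw [ha, lintegral_eq_zero_iff ((measurable_grad hfm).enorm.pow_const 4)]
      filter_upwards [hS k hk hkS] with x hx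
      simp [hx]
    simp [this, esqrt]
  have hw (k : ℕ) : ENNReal.ofReal (p k * (1 - p k)) * weight p k = 1 := by
    have := hμ.mul_pos k
    rw [weight, ← ENNReal.ofReal_mul this.le, mul_one_div_cancel this.ne', ENNReal.ofReal_one]
  calc _ ≤ ∑ k ∈ Finset.range n, 4 * esqrt (a k) :=
        Finset.sum_le_sum fun k _ => hμ.lintegral_remainder_le_of_bounded z n k hfm
    _ = 4 * ∑ k ∈ Finset.range n with k ∈ S, esqrt (a k) := by
        rw [← Finset.mul_sum, Finset.sum_filter]
        congr 1
        refine Finset.sum_congr rfl fun k hk => ?_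
        by_cases hkS : k ∈ S
        · rw [if_pos hkS]
        · rw [if_neg hkS, h0 k hk hkS]
    _ ≤ 4 * ∑ k ∈ S, esqrt (a k) := by
        gcongr
        intro k hk
        exact (Finset.mem_filter.1 hk).2
    -- Insert `p_k q_k` times its inverse weight, so that Cauchy–Schwarz over `k` separates the
    -- variance sum from `B₃`.
    _ = 4 * ∑ k ∈ S, esqrt (ENNReal.ofReal (p k * (1 - p k))) * esqrt (weight p k * a k) := by
        congr 1
        refine Finset.sum_congr rfl fun k _ => ?_
        rw [← esqrt_mul, ← mul_assoc, hw, one_mul]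
    _ ≤ 4 * (esqrt (∑ k ∈ S, ENNReal.ofReal (p k * (1 - p k))) *
        esqrt (∑ k ∈ S, weight p k * a k)) := by
        gcongr
        exact sum_esqrt_mul_esqrt_le _ _ _
    _ ≤ 4 * (ENNReal.ofReal √(∑ k ∈ S, p k * (1 - p k)) * esqrt (B3 p μ f)) := by
        rw [← ENNReal.ofReal_sum_of_nonneg fun k _ => (hμ.mul_pos k).le,
          esqrt_ofReal (Finset.sum_nonneg fun k _ => (hμ.mul_pos k).le)]
        gcongr
        exact esqrt_le_esqrt (ENNReal.sum_le_tsum S)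
    _ = _ := by
        rw [ENNReal.ofReal_mul (by norm_num), mul_assoc]
        norm_num

omit hμ in
lemma measurable_stepSeq (n k : ℕ) {f : (ℕ → ℝ) → ℝ} (hfm : Measurable f) :
    Measurable (stepSeq p μ n f k) :=
  ((measurable_grad hfm).mul
    (measurable_mixMean n (measurable_grad hfm)).abs).const_mul _

lemma lintegral_stepSeq_sq_le (n k : ℕ) {f : (ℕ → ℝ) → ℝ} (hfm : Measurable f) :
    ∫⁻ x, ‖stepSeq p μ n f k x‖ₑ ^ 2 ∂μ ≤ weight p k * ∫⁻ x, ‖grad p k f x‖ₑ ^ 4 ∂μ := by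
  have hm := measurable_grad (p := p) (k := k) hfm
  have hmm : Measurable fun x => ‖grad p k f x * mixMean μ n (grad p k f) x‖ₑ ^ 2 :=
    (hm.mul (measurable_mixMean n hm)).enorm.pow_const 2
  have e : ∀ x, ‖stepSeq p μ n f k x‖ₑ ^ 2 =
      weight p k * ‖grad p k f x * mixMean μ n (grad p k f) x‖ₑ ^ 2 := fun x => by
    rw [stepSeq, enorm_mul, mul_pow, hμ.enorm_inv_sqrt_sq, enorm_mul, enorm_mul, enorm_abs_real]
  simp only [e]
  rw [lintegral_const_mul _ hmm]
  refine mul_le_mul_right ?_ _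
  refine (hμ.lintegral_mul_mix_sq_le _ _ (subsetWeight_nonneg n) (sum_subsetWeight n).le
    hm hm).trans (le_of_eq ?_)
  rw [esqrt_mul_self]

/-- The gradient of `|G|` is dominated by that of `G`, so the product rule applies as for the
kernel. The weight of the sets containing `l` is estimated by 1 here, and the three terms contribute
`3 + 3 = 6` and `3`. -/
lemma lintegral_grad_stepSeq_sq_le (n k l : ℕ) {f : (ℕ → ℝ) → ℝ} (hfm : Measurable f)
    (hf : Integrable f μ) :
    ∫⁻ x, ‖grad p l (stepSeq p μ n f k) x‖ₑ ^ 2 ∂μ ≤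
      6 * (weight p k * esqrt (∫⁻ x, ‖grad p k f x‖ₑ ^ 4 ∂μ) *
        esqrt (∫⁻ x, ‖grad p l (grad p k f) x‖ₑ ^ 4 ∂μ)) +
      3 * (weight p k * weight p l * ∫⁻ x, ‖grad p l (grad p k f) x‖ₑ ^ 4 ∂μ) := by
  have hm := measurable_grad (p := p) (k := k) hfm
  have hm2 := measurable_grad (p := p) (k := l) hm
  set G := mixMean μ n (grad p k f) with hG
  set H : (ℕ → ℝ) → ℝ := fun x => ∑ A ∈ (Finset.range n).powerset with l ∈ A,
    subsetWeight n A * condMean μ A (grad p l (grad p k f)) x with hH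
  have hGm : Measurable G := measurable_mixMean n hm
  have hHm : Measurable H :=
    Finset.measurable_fun_sum _ fun A _ => (measurable_condMean A hm2).const_mul _
  have hpt : ∀ᵐ x ∂μ, ‖grad p l (stepSeq p μ n f k) x‖ₑ ^ 2 ≤ (weight p k * 3) *
      (‖grad p l (grad p k f) x * G x‖ₑ ^ 2 + ‖grad p k f x * H x‖ₑ ^ 2 +
        weight p l * ‖grad p l (grad p k f) x * H x‖ₑ ^ 2) := by
    filter_upwards [hμ.grad_mixMean n l (hμ.integrable_grad hf k), hμ.ae_sign l] with x hx hs
    have e1 : grad p l (stepSeq p μ n f k) x = (√(p k * (1 - p k)))⁻¹ *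
        grad p l (fun x => grad p k f x * |G x|) x := by
      simp only [grad, stepSeq, hG]; ring
    have hle : ‖grad p l (fun x => |G x|) x‖ₑ ≤ ‖H x‖ₑ := by
      rw [Real.enorm_eq_ofReal_abs, Real.enorm_eq_ofReal_abs]
      refine ENNReal.ofReal_le_ofReal ((abs_grad_abs_le p l G x).trans (le_of_eq ?_))
      rw [hx]
    rw [e1, enorm_mul, mul_pow, hμ.enorm_inv_sqrt_sq, hμ.grad_mul l _ _ hs, mul_assoc]
    gcongr
    refine (enorm_add_add_sq_le _ _ _).trans ?_
    rw [enorm_mul (-x l / _), mul_pow (‖-x l / _‖ₑ), hμ.enorm_coeff_sq l hs]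
    simp only [enorm_mul, enorm_abs_real]
    gcongr
  refine (lintegral_mono_ae hpt).trans ?_
  have hmm {a b : (ℕ → ℝ) → ℝ} (ha : Measurable a) (hb : Measurable b) :
      Measurable fun x => ‖a x * b x‖ₑ ^ 2 := (ha.mul hb).enorm.pow_const 2
  rw [lintegral_const_mul_add_add_const_mul _ _ (hmm hm2 hGm) (hmm hm hHm) (hmm hm2 hHm)]
  have hw : ∑ A ∈ (Finset.range n).powerset with l ∈ A, subsetWeight n A ≤ 1 :=
    (sum_subsetWeight_mem_le n l).trans (by norm_num)
  have b1 := hμ.lintegral_mul_mix_sq_le _ _ (subsetWeight_nonneg n) (sum_subsetWeight n).le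
    hm2 hm
  have b2 := hμ.lintegral_mul_mix_sq_le _ _ (subsetWeight_nonneg n) hw hm hm2
  have b3 := hμ.lintegral_mul_mix_sq_le _ _ (subsetWeight_nonneg n) hw hm2 hm2
  rw [esqrt_mul_self] at b3
  calc _ ≤ weight p k * 3 * (esqrt (∫⁻ x, ‖grad p l (grad p k f) x‖ₑ ^ 4 ∂μ) *
          esqrt (∫⁻ x, ‖grad p k f x‖ₑ ^ 4 ∂μ) + esqrt (∫⁻ x, ‖grad p k f x‖ₑ ^ 4 ∂μ) *
          esqrt (∫⁻ x, ‖grad p l (grad p k f) x‖ₑ ^ 4 ∂μ) +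
          weight p l * ∫⁻ x, ‖grad p l (grad p k f) x‖ₑ ^ 4 ∂μ) :=
        mul_le_mul_right (add_le_add (add_le_add b1 b2) (mul_le_mul_right b3 _)) _
    _ = _ := by ring

/-- The remainder, estimated through the divergence. -/
lemma sum_lintegral_remainder_le (z : ℝ) (n : ℕ) {f : (ℕ → ℝ) → ℝ} (hfm : Measurable f)
    (hf : MemLp f 2 μ) (hD : ∀ k, MemLp (grad p k f) 4 μ) :
    ∑ k ∈ Finset.range n, ∫⁻ x, ENNReal.ofReal (remainder p μ z n f k x) ∂μ ≤
      2 * esqrt (B3 p μ f) + ENNReal.ofReal (2 * √6) * esqrt (B4 p μ f) +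
        ENNReal.ofReal (2 * √3) * esqrt (B5 p μ f) := by
  have hu2 (k : ℕ) : MemLp (stepSeq p μ n f k) 2 μ := by
    rw [memLp_two_iff (measurable_stepSeq n k hfm).aestronglyMeasurable]
    refine (hμ.lintegral_stepSeq_sq_le n k hfm).trans_lt
      (ENNReal.mul_lt_top ENNReal.ofReal_lt_top
        ((memLp_four_iff (measurable_grad hfm).aestronglyMeasurable).1 (hD k)))
  have hhm : Measurable fun x => steinMono z (f x) := (measurable_steinMono z).comp hfm
  have hh2 : MemLp (fun x => steinMono z (f x)) 2 μ :=
    MemLp.of_bound hhm.aestronglyMeasurable 2 (.of_forall fun x => abs_steinMono_le z (f x))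
  set V : (ℕ → ℝ) → ℝ := fun x => ∑ k ∈ Finset.range n, normalized p k x * stepSeq p μ n f k x
    with hV
  have hY (k : ℕ) := hμ.memLp_normalized_mul (hu2 k) k
  have hV2 : MemLp V 2 μ := memLp_finsetSum _ fun k _ => hY k
  have hr (k : ℕ) : Integrable (remainder p μ z n f k) μ :=
    integrable_fun_mul (hμ.memLp_grad hh2 k) (hu2 k)
  -- The summands are nonnegative because `h` is increasing, so they are genuine expectations; as
  -- `u_k` is free of coordinate `k`, integration by parts moves the gradient off `h(F)`, which need
  -- then only be bounded.
  have e1 : ∑ k ∈ Finset.range n, ∫⁻ x, ENNReal.ofReal (remainder p μ z n f k x) ∂μ =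
      ENNReal.ofReal (∫ x, steinMono z (f x) * V x ∂μ) := by
    have (k : ℕ) : ∫⁻ x, ENNReal.ofReal (remainder p μ z n f k x) ∂μ =
        ENNReal.ofReal (∫ x, remainder p μ z n f k x ∂μ) :=
      (ofReal_integral_eq_lintegral_ofReal (hr k)
        (.of_forall fun x => hμ.remainder_nonneg z n f k x)).symm
    simp only [this]
    rw [← ENNReal.ofReal_sum_of_nonneg fun k _ =>
      integral_nonneg fun x => hμ.remainder_nonneg z n f k x]
    congr 1
    simp only [hV, Finset.mul_sum]
    rw [integral_finsetSum _ fun k _ => integrable_fun_mul hh2 (hY k)]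
    exact Finset.sum_congr rfl fun k _ =>
      hμ.integral_grad_mul (free_stepSeq p μ n f k) (integrable_fun_mul hh2 (hu2 k))
  have hVsq : ∫⁻ x, ‖V x‖ₑ ^ 2 ∂μ ≤ B3 p μ f + (6 * B4 p μ f + 3 * B5 p μ f) := by
    have h := ENNReal.ofReal_le_ofReal (hμ.integral_sum_normalized_mul_sq_le (Finset.range n)
      (fun k => free_stepSeq p μ n f k) hu2)
    rw [ENNReal.ofReal_add (Finset.sum_nonneg fun k _ => integral_nonneg fun x => sq_nonneg _)
      (Finset.sum_nonneg fun k _ => Finset.sum_nonneg fun l _ =>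
        integral_nonneg fun x => sq_nonneg _),
      ENNReal.ofReal_sum_of_nonneg fun k _ => integral_nonneg fun x => sq_nonneg _,
      ENNReal.ofReal_sum_of_nonneg fun k _ => Finset.sum_nonneg fun l _ =>
        integral_nonneg fun x => sq_nonneg _] at h
    have e2 (k : ℕ) : ENNReal.ofReal (∑ l ∈ Finset.range n,
        ∫ x, grad p l (stepSeq p μ n f k) x ^ 2 ∂μ) =
        ∑ l ∈ Finset.range n, ∫⁻ x, ‖grad p l (stepSeq p μ n f k) x‖ₑ ^ 2 ∂μ := by
      rw [ENNReal.ofReal_sum_of_nonneg fun l _ => integral_nonneg fun x => sq_nonneg _]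
      exact Finset.sum_congr rfl fun l _ => (lintegral_enorm_sq (hμ.memLp_grad (hu2 k) l)).symm
    simp only [e2, ← lintegral_enorm_sq (hu2 _)] at h
    rw [lintegral_enorm_sq hV2]
    refine h.trans (add_le_add ?_ ?_)
    · exact (Finset.sum_le_sum fun k _ => hμ.lintegral_stepSeq_sq_le n k hfm).trans
        (ENNReal.sum_le_tsum _)
    · have hfi := hf.integrable (by norm_num)
      calc _ ≤ ∑' (k : ℕ) (l : ℕ), (6 * (weight p k * esqrt (∫⁻ x, ‖grad p k f x‖ₑ ^ 4 ∂μ) *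
            esqrt (∫⁻ x, ‖grad p l (grad p k f) x‖ₑ ^ 4 ∂μ)) +
            3 * (weight p k * weight p l * ∫⁻ x, ‖grad p l (grad p k f) x‖ₑ ^ 4 ∂μ)) :=
            (Finset.sum_le_sum fun k _ => (Finset.sum_le_sum fun l _ =>
              hμ.lintegral_grad_stepSeq_sq_le n k l hfm hfi).trans
              (ENNReal.sum_le_tsum _)).trans (ENNReal.sum_le_tsum _)
        _ = _ := by
            simp only [ENNReal.tsum_add, ENNReal.tsum_mul_left, B4, B5]
  rw [e1]
  calc _ ≤ ∫⁻ x, ‖steinMono z (f x) * V x‖ₑ ∂μ :=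
        (ENNReal.ofReal_le_ofReal (le_abs_self _)).trans
          ((Real.enorm_eq_ofReal_abs _).symm.le.trans (enorm_integral_le_lintegral_enorm _))
    _ ≤ ∫⁻ x, 2 * ‖V x‖ₑ ∂μ := by
        refine lintegral_mono fun x => ?_
        rw [enorm_mul]
        gcongr
        rw [Real.enorm_eq_ofReal_abs, show (2 : ℝ≥0∞) = ENNReal.ofReal 2 by norm_num]
        exact ENNReal.ofReal_le_ofReal (abs_steinMono_le z (f x))
    _ ≤ 2 * esqrt (∫⁻ x, ‖V x‖ₑ ^ 2 ∂μ) := by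
        rw [lintegral_const_mul' _ _ (by norm_num)]
        gcongr
        exact le_esqrt (lintegral_sq_le hV2.1.enorm)
    _ ≤ 2 * (esqrt (B3 p μ f) + (esqrt (6 * B4 p μ f) + esqrt (3 * B5 p μ f))) := by
        gcongr
        exact (esqrt_le_esqrt hVsq).trans ((esqrt_add_le _ _).trans
          (add_le_add le_rfl (esqrt_add_le _ _)))
    _ = _ := by
        rw [esqrt_mul, esqrt_mul, show (6 : ℝ≥0∞) = ENNReal.ofReal 6 by norm_num,
          show (3 : ℝ≥0∞) = ENNReal.ofReal 3 by norm_num, esqrt_ofReal (by norm_num),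
          esqrt_ofReal (by norm_num), ENNReal.ofReal_mul (by norm_num),
          ENNReal.ofReal_mul (by norm_num), ENNReal.ofReal_ofNat]
        ring

end IsRademacherLaw

/-! ### Transfer to the probability space and conclusion. -/

/-- A functional on the signs has a measurable version. -/
lemma exists_measurable_eq_on_signs {m : ℕ} (g : (Fin m → ℝ) → ℝ) :
    ∃ g' : (Fin m → ℝ) → ℝ, Measurable g' ∧
      ∀ x : Fin m → ℝ, (∀ i, x i = 1 ∨ x i = -1) → g' x = g x := by
  set S : Finset (Fin m → ℝ) := Fintype.piFinset fun _ => {1, -1}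
  refine ⟨fun x => ∑ s ∈ S, Set.indicator {s} (fun _ => g s) x,
    Finset.measurable_fun_sum _ fun s _ =>
      measurable_const.indicator (measurableSet_singleton s), fun x hx => ?_⟩
  have hxS : x ∈ S := by simpa [S] using hx
  simp only
  rw [Finset.sum_eq_single x]
  · simp
  · intro s _ hs
    exact Set.indicator_of_notMem (by simpa using hs.symm) _
  · exact fun h => absurd hxS h

namespace IsRademacherLaw

variable {p : ℕ → ℝ} {μ : Measure (ℕ → ℝ)} (hμ : IsRademacherLaw p μ)

include hμ

lemma memLp_grad_four_of_B3_ne_top {f : (ℕ → ℝ) → ℝ} (hfm : Measurable f)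
    (h : B3 p μ f ≠ ∞) (k : ℕ) : MemLp (grad p k f) 4 μ := by
  refine (memLp_four_iff (measurable_grad hfm).aestronglyMeasurable).2 ?_
  have h1 : weight p k * ∫⁻ x, ‖grad p k f x‖ₑ ^ 4 ∂μ ≠ ∞ :=
    ne_top_of_le_ne_top h (ENNReal.le_tsum k)
  refine ENNReal.lt_top_of_mul_ne_top_right h1 ?_
  rw [weight, ne_eq, ENNReal.ofReal_eq_zero, not_le]
  exact one_div_pos.2 (hμ.mul_pos k)

lemma grad_ae_eq_zero_of_ae_eq {m k : ℕ} (hk : m ≤ k) {f : (ℕ → ℝ) → ℝ}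
    {g : (Fin m → ℝ) → ℝ} (h : ∀ᵐ x ∂μ, f x = g fun i => x i) : grad p k f =ᵐ[μ] 0 := by
  filter_upwards [hμ.ae_update h k (.inl rfl), hμ.ae_update h k (.inr rfl)] with x h1 h2
  have e (c : ℝ) : (fun i : Fin m => Function.update x k c i) = fun i : Fin m => x i := by
    funext i
    exact Function.update_of_ne (by have := i.2; omega) _ _
  rw [grad, h1, h2, e, e, sub_self, mul_zero, Pi.zero_apply]

end IsRademacherLaw

end

end Rademacher

theorem theorem4p1 {Ω : Type*} [MeasurableSpace Ω] (P : MeasureTheory.Measure Ω)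
    [MeasureTheory.IsProbabilityMeasure P] (p : ℕ → ℝ) (X : ℕ → Ω → ℝ)
    (hX : Rademacher.IsRademacherSequence p X P)
    (F : Ω → ℝ) (f : (ℕ → ℝ) → ℝ) (hf : Measurable f)
    (hFf : ∀ᵐ ω ∂P, F ω = f (fun k => X k ω))
    (hD : Rademacher.MemD12 p (Rademacher.seqLaw X P) f)
    (hmean : ∫ ω, F ω ∂P = 0) (hvar : ProbabilityTheory.variance F P = 1) :
    ((∀ z : ℝ, Rademacher.MemD12 p (Rademacher.seqLaw X P) (Rademacher.steinFunctional z f)) →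
      Rademacher.MemDomDelta p (Rademacher.seqLaw X P)
        (Rademacher.uSeq p (Rademacher.seqLaw X P) f hD.memLp) →
      Rademacher.kolmogorovDist (P.map F) (ProbabilityTheory.gaussianReal 0 1) ≤
        ENNReal.ofReal (√15 / 2) * Rademacher.esqrt (Rademacher.B1 p (Rademacher.seqLaw X P) f) +
        ENNReal.ofReal (√3 / 2) * Rademacher.esqrt (Rademacher.B2 p (Rademacher.seqLaw X P) f) +
        2 * Rademacher.esqrt (Rademacher.B3 p (Rademacher.seqLaw X P) f) +
        ENNReal.ofReal (2 * √6) * Rademacher.esqrt (Rademacher.B4 p (Rademacher.seqLaw X P) f) +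
        ENNReal.ofReal (2 * √3) * Rademacher.esqrt (Rademacher.B5 p (Rademacher.seqLaw X P) f)) ∧
    ((∀ k, MeasureTheory.MemLp (Rademacher.grad p k f) 4 (Rademacher.seqLaw X P)) →
      (Summable (fun k => p k * (1 - p k)) →
        Rademacher.kolmogorovDist (P.map F) (ProbabilityTheory.gaussianReal 0 1) ≤
          ENNReal.ofReal (√15 / 2) * Rademacher.esqrt (Rademacher.B1 p (Rademacher.seqLaw X P) f) +
          ENNReal.ofReal (√3 / 2) * Rademacher.esqrt (Rademacher.B2 p (Rademacher.seqLaw X P) f) +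
          ENNReal.ofReal (4 * √(∑' k, p k * (1 - p k))) *
            Rademacher.esqrt (Rademacher.B3 p (Rademacher.seqLaw X P) f)) ∧
      (∀ m : ℕ, (∃ g : (Fin m → ℝ) → ℝ, ∀ᵐ ω ∂P, F ω = g (fun i => X i ω)) →
        Rademacher.kolmogorovDist (P.map F) (ProbabilityTheory.gaussianReal 0 1) ≤
          ENNReal.ofReal (√15 / 2) * Rademacher.esqrt (Rademacher.B1 p (Rademacher.seqLaw X P) f) +
          ENNReal.ofReal (√3 / 2) * Rademacher.esqrt (Rademacher.B2 p (Rademacher.seqLaw X P) f) +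
          ENNReal.ofReal (4 * √(∑ k ∈ Finset.range m, p k * (1 - p k))) *
            Rademacher.esqrt (Rademacher.B3 p (Rademacher.seqLaw X P) f))) := by
  have hμ := Rademacher.isRademacherLaw_seqLaw hX
  have hXm : Measurable fun ω k => X k ω := measurable_pi_lambda _ hX.measurable
  have : MeasureTheory.IsProbabilityMeasure (Rademacher.seqLaw X P) :=
    MeasureTheory.Measure.isProbabilityMeasure_map hXm.aemeasurable
  have hFm : AEMeasurable F P := ⟨_, hf.comp hXm, hFf⟩
  have hmap : P.map F = (Rademacher.seqLaw X P).map f := by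
    rw [MeasureTheory.Measure.map_congr hFf, Rademacher.seqLaw,
      MeasureTheory.Measure.map_map hf hXm]
    rfl
  have h0 : ∫ x, f x ∂(Rademacher.seqLaw X P) = 0 := by
    rw [Rademacher.seqLaw, MeasureTheory.integral_map hXm.aemeasurable hf.aestronglyMeasurable,
      ← hmean]
    exact MeasureTheory.integral_congr_ae (hFf.mono fun ω h => h.symm)
  have h1 : ∫ x, f x ^ 2 ∂(Rademacher.seqLaw X P) = 1 := by
    rw [Rademacher.seqLaw, MeasureTheory.integral_map hXm.aemeasurable
      (hf.pow_const 2).aestronglyMeasurable, ← hvar,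
      ProbabilityTheory.variance_of_integral_eq_zero hFm hmean]
    refine MeasureTheory.integral_congr_ae (hFf.mono fun ω h => ?_)
    simp only [h]
  refine ⟨fun _ _ => ?_, fun hD4 => ⟨fun hsum => ?_, fun m ⟨g, hg⟩ => ?_⟩⟩
  -- If `B₃ = ∞` the bound is trivial. Otherwise its finiteness yields the fourth moments of the
  -- gradients.
  · by_cases hB : Rademacher.B3 p (Rademacher.seqLaw X P) f = ∞
    · rw [hB, Rademacher.esqrt_top, ENNReal.mul_top two_ne_zero]
      simp
    refine iSup_le fun z => ?_
    rw [hmap]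
    have hD4 := hμ.memLp_grad_four_of_B3_ne_top hf hB
    refine (hμ.ofReal_abs_measure_sub_Phi_le z hf hD.memLp h0 h1 hD4
      fun n => hμ.sum_lintegral_remainder_le z n hf hD.memLp hD4).trans (le_of_eq ?_)
    simp only [add_assoc]
  · refine iSup_le fun z => ?_
    rw [hmap]
    refine hμ.ofReal_abs_measure_sub_Phi_le z hf hD.memLp h0 h1 hD4 fun n => ?_
    refine (hμ.sum_lintegral_remainder_le_of_finset z n hf (Finset.range n)
      fun k hk hk' => absurd hk hk').trans ?_
    gcongr
    exact hsum.sum_le_tsum _ fun k _ => (hμ.mul_pos k).le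
  · refine iSup_le fun z => ?_
    rw [hmap]
    refine hμ.ofReal_abs_measure_sub_Phi_le z hf hD.memLp h0 h1 hD4 fun n => ?_
    refine hμ.sum_lintegral_remainder_le_of_finset z n hf (Finset.range m) fun k _ hk => ?_
    -- The given `g` may fail to be measurable, but only its values on finitely many sign vectors
    -- matter. A measurable version is needed to pull the almost sure identity back from the law to
    -- `P`.
    obtain ⟨g', hg', hgg'⟩ := Rademacher.exists_measurable_eq_on_signs g
    refine hμ.grad_ae_eq_zero_of_ae_eq (by simpa using hk) (g := g') ?_
    have hgm : Measurable fun x : ℕ → ℝ => g' fun i : Fin m => x i :=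
      hg'.comp (measurable_pi_lambda _ fun i => measurable_pi_apply _)
    rw [Rademacher.seqLaw, MeasureTheory.ae_map_iff hXm.aemeasurable
      (measurableSet_eq_fun hf hgm)]
    have hsign : ∀ᵐ ω ∂P, ∀ k, X k ω = 1 ∨ X k ω = -1 :=
      MeasureTheory.ae_all_iff.2 fun k =>
        MeasureTheory.ae_of_ae_map hXm.aemeasurable (hμ.ae_sign k)
    filter_upwards [hFf, hg, hsign] with ω h2 h3 h4
    rw [← h2, h3, hgg' _ fun i => h4 i]
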